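/- For all real $\varepsilon,\delta,B>0$ there exists a constant $C=C(\varepsilon,\delta,B)>0$ such that the following holds. Let $N\ge 2$ be an integer and let $\mathbf x$ be a complex random variable which is symmetric (that is, $\mathbf x$ and $-\mathbf x$ have the same law), with $\mathbb E[|\mathbf x|^2]\le 1$ and $\mathbb E[|\mathbf x|^{2+\varepsilon}]\le B$. Let $X_N=(X_{i,j})_{1\le i,j\le N}$ be a random $N\times N$ matrix whose entries $X_{i,j}$ are independent copies of $\mathbf x$, and let $\rho(X_N)=\max\{|\lambda| : \lambda\in\mathbb C \text{ is an eigenvalue of } X_N\}$ be its spectral radius. Then $$\mathbb P\big(\rho(X_N)\ge (1+\delta)\sqrt N\big)\le \frac{C}{(\log N)^2}.$$ -/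

import Mathlib

open MeasureTheory ProbabilityTheory

/-! Every eigenvalue satisfies |λ|^(2k) ≤ N‖X^k‖² in Frobenius norm, and k ≈ (log N)² makes (1+δ)^k
beat any fixed power of N. The norm is a sum over pairs of walks of length k with common endpoints.
As the entries are symmetric, random signs may be attached to them, and averaging keeps only the
pairs that use each directed edge an even number of times (`sum_signed_le`). Closing both walks by
the edge from their end to their start gives a closed word of length n = 2L, L = k+1, with the same
parities.

High powers of an entry may have infinite mean, so expectations are not taken word by word. An even
word runs twice over a union of simple directed cycles (`exists_cycle_family`), and `CycleBound`
requires the sums over simple cycles and paths of the weights |X_e|^(2(1+η)) to be at most K times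
(Nβ)^(m+1). The edges of a simple cycle are distinct, so independence bounds the means using only
E|x|^(2(1+η)) ≤ β = 1+δ. By Markov the event fails with probability at most 2L/K, which is 2/(k+1)
for K = L²; this gives the rate. The event depends on moduli only, hence is compatible with the
signs.

On this event, a pattern with v vertices needs at most L-v+1 cycles, and interpolation against the
at most N^v words of the pattern gains (K N^(-η/(1+η)))^(L-v) (`sum_wordWeight_le`). Such a pattern
is determined by at most 4(L-v)+1 exceptional steps (`IsCanonical.card_code_le`), so the gain
outweighs the number of patterns. The averaged norm is then at most (Nβ)^L times a polynomial in k,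
and Markov's inequality concludes. -/

/-! ### Simple cycles and decomposition of balanced edge multisets. -/

/-- A simple directed cycle with `len + 1` edges: vertex `i` is followed by vertex `i + 1`,
taken modulo `len + 1`. -/
structure SimpleCycle (α : Type*) where
  len : ℕ
  toFun : Fin (len + 1) → α
  inj : Function.Injective toFun

namespace SimpleCycle

variable {α : Type*}

/-- The edges of a cycle. -/
def edges (C : SimpleCycle α) : Multiset (α × α) :=
  Finset.univ.val.map fun i ↦ (C.toFun i, C.toFun (i + 1))

/-- The cycle started `j` steps later. -/
def rotate (C : SimpleCycle α) (j : Fin (C.len + 1)) : SimpleCycle α where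
  len := C.len
  toFun i := C.toFun (i + j)
  inj := C.inj.comp (add_left_injective j)

theorem card_edges (C : SimpleCycle α) : C.edges.card = C.len + 1 := by
  simp [edges]

theorem nodup_edges (C : SimpleCycle α) : C.edges.Nodup := by
  refine Multiset.Nodup.map (fun i j h ↦ C.inj ?_) Finset.univ.nodup
  exact (Prod.ext_iff.1 h).1

theorem mem_edges {C : SimpleCycle α} {e : α × α} :
    e ∈ C.edges ↔ ∃ i, (C.toFun i, C.toFun (i + 1)) = e := by
  simp only [edges, Multiset.mem_map, Finset.mem_val, Finset.mem_univ, true_and]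

theorem map_univ_equiv {ι β : Type*} [Fintype ι] (e : ι ≃ ι) (f : ι → β) :
    (Finset.univ : Finset ι).val.map (fun i ↦ f (e i)) = Finset.univ.val.map f := by
  have := congrArg (Multiset.map f) (congrArg Finset.val (Finset.map_univ_equiv e))
  rwa [Finset.map_val, Multiset.map_map] at this

theorem map_fst_edges (C : SimpleCycle α) : C.edges.map Prod.fst = C.edges.map Prod.snd := by
  simp only [edges, Multiset.map_map, Function.comp_def]
  exact (map_univ_equiv (Equiv.addRight 1) C.toFun).symm

theorem edges_rotate (C : SimpleCycle α) (j : Fin (C.len + 1)) :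
    (C.rotate j).edges = C.edges := by
  have := map_univ_equiv (Equiv.addRight j) fun i ↦ (C.toFun i, C.toFun (i + 1))
  simp only [edges, rotate]
  rw [← this]
  refine Multiset.map_congr rfl fun i _ ↦ ?_
  exact congrArg (fun a ↦ (C.toFun (i + j), C.toFun a)) (add_right_comm i 1 j)

/-- A cycle through the edge `(x, y)` can be started at `y`, so that it ends at `x`. -/
theorem exists_rotate {C : SimpleCycle α} {x y : α} (h : (x, y) ∈ C.edges) :
    ∃ D : SimpleCycle α, D.edges = C.edges ∧ D.toFun (Fin.last _) = x ∧ D.toFun 0 = y := by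
  obtain ⟨i, hi⟩ := mem_edges.1 h
  obtain ⟨rfl, rfl⟩ := Prod.ext_iff.1 hi
  refine ⟨C.rotate (i + 1), edges_rotate _ _, ?_, ?_⟩
  · change C.toFun (Fin.last C.len + (i + 1)) = C.toFun i
    congr 1
    rw [add_comm i, ← add_assoc, Fin.last_add_one, zero_add]
  · change C.toFun (0 + (i + 1)) = C.toFun (i + 1)
    rw [zero_add]

/-- A nonempty balanced multiset of edges contains the edges of a simple cycle. -/
theorem exists_edges_le [Finite α] {M : Multiset (α × α)}
    (hM : M.map Prod.fst = M.map Prod.snd) (h0 : M ≠ 0) :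
    ∃ C : SimpleCycle α, C.edges ≤ M := by
  classical
  obtain ⟨⟨x₀, y₀⟩, h₀⟩ := Multiset.exists_mem_of_ne_zero h0
  have hstep : ∀ x y, (x, y) ∈ M → ∃ z, (y, z) ∈ M := by
    intro x y hxy
    have : y ∈ M.map Prod.fst := hM ▸ Multiset.mem_map_of_mem Prod.snd hxy
    obtain ⟨⟨a, z⟩, haz, rfl⟩ := Multiset.mem_map.1 this
    exact ⟨z, haz⟩
  -- `f` selects one outgoing edge per vertex; balance keeps its orbit inside `M`, so the default
  -- value `x` is never met there. One minimal period of the orbit is a simple cycle, and since its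
  -- edges are distinct, membership in `M` suffices for `≤`.
  let f : α → α := fun x ↦ if h : ∃ y, (x, y) ∈ M then h.choose else x
  have hf : ∀ x y, (x, y) ∈ M → (x, f x) ∈ M := by
    intro x y hxy
    have h : ∃ y, (x, y) ∈ M := ⟨y, hxy⟩
    simp only [f, dif_pos h]
    exact h.choose_spec
  have hiter : ∀ t, (f^[t] x₀, f (f^[t] x₀)) ∈ M := by
    intro t
    induction t with
    | zero => exact hf _ _ h₀
    | succ t ih =>
      obtain ⟨z, hz⟩ := hstep _ _ ih
      rw [Function.iterate_succ_apply']
      exact hf _ _ hz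
  obtain ⟨i, j, hij, hfij⟩ : ∃ i j : ℕ, i < j ∧ f^[i] x₀ = f^[j] x₀ := by
    obtain ⟨i, j, hne, h⟩ := Finite.exists_ne_map_eq_of_infinite fun t : ℕ ↦ f^[t] x₀
    rcases lt_or_gt_of_ne hne with h' | h'
    · exact ⟨i, j, h', h⟩
    · exact ⟨j, i, h', h.symm⟩
  set z := f^[i] x₀ with hz
  have hper : Function.IsPeriodicPt f (j - i) z := by
    rw [Function.IsPeriodicPt, Function.IsFixedPt, hz, ← Function.iterate_add_apply,
      Nat.sub_add_cancel hij.le]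
    exact hfij.symm
  have hpos : 0 < Function.minimalPeriod f z := hper.minimalPeriod_pos (by omega)
  obtain ⟨m, hm⟩ : ∃ m, Function.minimalPeriod f z = m + 1 := ⟨_, (Nat.succ_pred_eq_of_pos hpos).symm⟩
  let C : SimpleCycle α :=
    { len := m
      toFun := fun i ↦ f^[i] z
      inj := by
        intro a b hab
        have := Function.iterate_injOn_Iio_minimalPeriod (f := f) (x := z)
          (hm.symm ▸ a.2 : (a : ℕ) < _) (hm.symm ▸ b.2 : (b : ℕ) < _) hab
        exact Fin.ext this }
  refine ⟨C, (Multiset.le_iff_subset C.nodup_edges).2 fun e he ↦ ?_⟩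
  obtain ⟨a, rfl⟩ := mem_edges.1 he
  have h1 : C.toFun (a + 1) = f (C.toFun a) := by
    change f^[((a + 1 : Fin (m + 1)) : ℕ)] z = f (f^[(a : ℕ)] z)
    rw [← Function.iterate_succ_apply' f, ← Function.iterate_mod_minimalPeriod_eq (n := (a : ℕ).succ),
      hm, Fin.val_add]
    simp [C]
  rw [h1]
  change (f^[a] z, f (f^[a] z)) ∈ M
  rw [hz, ← Function.iterate_add_apply]
  exact hiter _

/-- A balanced multiset of edges is a sum of simple cycles. -/
theorem exists_decomposition [Finite α] (M : Multiset (α × α))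
    (hM : M.map Prod.fst = M.map Prod.snd) :
    ∃ (r : ℕ) (C : Fin r → SimpleCycle α), M = ∑ i, (C i).edges := by
  classical
  induction h : M.card using Nat.strong_induction_on generalizing M with
  | _ c ih =>
    by_cases h0 : M = 0
    · exact ⟨0, Fin.elim0, by simp [h0]⟩
    obtain ⟨C, hC⟩ := exists_edges_le hM h0
    obtain ⟨M', rfl⟩ := Multiset.le_iff_exists_add.1 hC
    rw [Multiset.map_add, Multiset.map_add, C.map_fst_edges] at hM
    obtain ⟨r, D, hD⟩ := ih M'.card (by rw [← h, Multiset.card_add, card_edges]; omega) M'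
      (add_left_cancel hM) rfl
    exact ⟨r + 1, Fin.cons C D, by rw [Fin.sum_univ_succ]; simp [hD]⟩

end SimpleCycle

/-! ### Edge multisets of closed words. -/

/-- The edges of the closed walk `w`, whose last vertex is followed by the first one. -/
def wordEdges {n : ℕ} [NeZero n] {α : Type*} (w : Fin n → α) : Multiset (α × α) :=
  Finset.univ.val.map fun t ↦ (w t, w (t + 1))

section wordEdges

variable {n : ℕ} [NeZero n] {α β : Type*}

theorem card_wordEdges (w : Fin n → α) : (wordEdges w).card = n := by
  simp [wordEdges]

theorem mem_wordEdges {w : Fin n → α} {e : α × α} :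
    e ∈ wordEdges w ↔ ∃ t, (w t, w (t + 1)) = e := by
  simp only [wordEdges, Multiset.mem_map, Finset.mem_val, Finset.mem_univ, true_and]

theorem wordEdges_comp (f : α → β) (w : Fin n → α) :
    wordEdges (f ∘ w) = (wordEdges w).map (Prod.map f f) := by
  simp [wordEdges, Function.comp_def]

theorem map_fst_wordEdges (w : Fin n → α) :
    (wordEdges w).map Prod.fst = (wordEdges w).map Prod.snd := by
  simp only [wordEdges, Multiset.map_map, Function.comp_def]
  exact (SimpleCycle.map_univ_equiv (Equiv.addRight 1) w).symm

theorem count_wordEdges [DecidableEq α] (w : Fin n → α) (e : α × α) :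
    (wordEdges w).count e = (Finset.univ.filter fun t ↦ (w t, w (t + 1)) = e).card := by
  rw [wordEdges, Multiset.count_map, Finset.card_def, Finset.filter_val]
  congr 1
  exact Multiset.filter_congr fun t _ ↦ eq_comm

end wordEdges

/-- `Even M` means `M = H + H`; the half `H` is what gets decomposed into cycles. -/
theorem even_multiset_iff {α : Type*} [DecidableEq α] {M : Multiset α} :
    Even M ↔ ∀ e, Even (M.count e) := by
  constructor
  · rintro ⟨H, rfl⟩ e
    exact ⟨H.count e, Multiset.count_add ..⟩
  · intro h
    refine ⟨∑ e ∈ M.toFinset, Multiset.replicate (M.count e / 2) e, ?_⟩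
    ext e
    rw [Multiset.count_add, Multiset.count_sum']
    simp only [Multiset.count_replicate, Finset.sum_ite_eq', Multiset.mem_toFinset]
    obtain ⟨c, hc⟩ := h e
    split_ifs with he
    · omega
    · rw [Multiset.count_eq_zero_of_notMem he, add_zero]

/-! ### Patterns of words. -/

section canon

variable {n : ℕ} [NeZero n] {α : Type*} [DecidableEq α]

/-- The first position at which the word `w` visits `x`. -/
noncomputable def firstVisit (w : Fin n → α) (x : α) : Fin n :=
  if h : (Finset.univ.filter fun s ↦ w s = x).Nonempty then Finset.min' _ h else 0

/-- The pattern of a word: each letter is replaced by the position of its first occurrence. -/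
noncomputable def canon (w : Fin n → α) (t : Fin n) : Fin n := firstVisit w (w t)

/-- Words that are their own pattern. -/
def IsCanonical (τ : Fin n → Fin n) : Prop := ∀ t, τ t ≤ t ∧ τ (τ t) = τ t

theorem apply_canon (w : Fin n → α) (t : Fin n) : w (canon w t) = w t := by
  have h : (Finset.univ.filter fun s ↦ w s = w t).Nonempty := ⟨t, by simp⟩
  have := Finset.min'_mem _ h
  rw [canon, firstVisit, dif_pos h]
  simpa using this

theorem canon_le (w : Fin n → α) {s t : Fin n} (h : w s = w t) : canon w t ≤ s := by
  have h' : (Finset.univ.filter fun s ↦ w s = w t).Nonempty := ⟨t, by simp⟩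
  rw [canon, firstVisit, dif_pos h']
  exact Finset.min'_le _ _ (by simpa using h)

theorem isCanonical_canon (w : Fin n → α) : IsCanonical (canon w) := by
  refine fun t ↦ ⟨canon_le w rfl, ?_⟩
  exact congrArg (firstVisit w) (apply_canon w t)

theorem even_wordEdges_canon {w : Fin n → α} (h : Even (wordEdges w)) :
    Even (wordEdges (canon w)) := by
  obtain ⟨H, hH⟩ := h
  change Even (wordEdges (firstVisit w ∘ w))
  rw [wordEdges_comp, hH, Multiset.map_add]
  exact ⟨_, rfl⟩

end canon

/-! ### Encoding canonical words by their exceptional steps. -/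

namespace IsCanonical

open Finset

variable {n : ℕ} {τ : Fin n → Fin n}

/-- The vertices of a canonical word. -/
def verts (τ : Fin n → Fin n) : Finset (Fin n) := univ.filter fun t ↦ τ t = t

theorem image_eq_verts (h : IsCanonical τ) : univ.image τ = verts τ := by
  ext u
  simp only [verts, mem_image, mem_univ, true_and, mem_filter]
  exact ⟨by rintro ⟨t, rfl⟩; exact (h t).2, fun hu ↦ ⟨u, hu⟩⟩

variable [NeZero n]

theorem apply_zero (h : IsCanonical τ) : τ 0 = 0 := by
  simpa using (h 0).1

/-- Steps that do not follow the first edge that was used to leave the current vertex. -/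
def branchSteps (τ : Fin n → Fin n) : Finset (Fin n) :=
  univ.filter fun t ↦ τ (t + 1) ≠ τ (τ t + 1)

/-- Steps that leave a new vertex towards an old one. -/
def returnSteps (τ : Fin n → Fin n) : Finset (Fin n) :=
  univ.filter fun t ↦ τ t = t ∧ τ (t + 1) ≠ t + 1

/-- The exceptional steps of a canonical word with their targets. -/
def code (τ : Fin n → Fin n) : Finset (Fin n × Fin n) :=
  (branchSteps τ ∪ returnSteps τ).image fun t ↦ (t, τ (t + 1))

theorem mem_code {t y : Fin n} :
    (t, y) ∈ code τ ↔ t ∈ branchSteps τ ∪ returnSteps τ ∧ τ (t + 1) = y := by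
  simp only [code, mem_image, Prod.mk.injEq]
  constructor
  · rintro ⟨a, ha, rfl, rfl⟩
    exact ⟨ha, rfl⟩
  · rintro ⟨h1, h2⟩
    exact ⟨t, h1, rfl, h2⟩

/-- The first edge used to leave a vertex has positive even multiplicity, so each vertex accounts
for at least two non-branching steps. -/
theorem card_branchSteps_le (h : IsCanonical τ) (he : Even (wordEdges τ)) :
    (branchSteps τ).card + 2 * (verts τ).card ≤ n := by
  have h1 : (branchSteps τ).card + (univ.filter fun t ↦ τ (t + 1) = τ (τ t + 1)).card = n := by
    rw [add_comm, branchSteps, card_filter_add_card_filter_not, card_univ, Fintype.card_fin]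
  have h2 : 2 * (verts τ).card ≤ (univ.filter fun t ↦ τ (t + 1) = τ (τ t + 1)).card := by
    rw [mul_comm, ← smul_eq_mul, ← sum_const, card_eq_sum_card_fiberwise (f := τ) (t := verts τ)]
    · refine sum_le_sum fun u hu ↦ ?_
      have hu' : τ u = u := (mem_filter.1 hu).2
      have h3 : ((univ.filter fun t ↦ τ (t + 1) = τ (τ t + 1)).filter fun t ↦ τ t = u).card =
          (wordEdges τ).count (u, τ (u + 1)) := by
        rw [count_wordEdges, filter_filter]
        congr 1
        refine filter_congr fun t _ ↦ ?_
        simp only [Prod.mk.injEq]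
        constructor
        · rintro ⟨a, rfl⟩; exact ⟨rfl, a⟩
        · rintro ⟨rfl, b⟩; exact ⟨b, rfl⟩
      rw [h3]
      have h4 : 0 < (wordEdges τ).count (u, τ (u + 1)) :=
        Multiset.count_pos.2 (mem_wordEdges.2 ⟨u, by rw [hu']⟩)
      obtain ⟨c, hc⟩ := even_multiset_iff.1 he (u, τ (u + 1))
      omega
    · intro t _
      exact mem_filter.2 ⟨mem_univ _, (h t).2⟩
  omega

theorem val_add_one_of_lt' {s t : Fin n} (h : s < t) : ((s + 1 : Fin n) : ℕ) = s + 1 := by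
  rw [Fin.val_add, Fin.val_one', Nat.add_mod_mod]
  exact Nat.mod_eq_of_lt (by have := t.2; have : (s : ℕ) < t := h; omega)

/-- There are as many arrivals at new vertices, counted cyclically, as vertices. A vertex whose
first exit is a return must be compensated by an arrival that starts from an already visited vertex,
and such a step branches. -/
theorem card_returnSteps_le (h : IsCanonical τ) :
    (returnSteps τ).card ≤ (branchSteps τ).card + 1 := by
  have hpos : 0 < n := Nat.pos_of_ne_zero (NeZero.ne n)
  let R := univ.filter fun t : Fin n ↦ τ (t + 1) = t + 1
  have h1 : R.card = (verts τ).card :=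
    card_bij (fun t _ ↦ t + 1) (fun t ht ↦ mem_filter.2 ⟨mem_univ _, (mem_filter.1 ht).2⟩)
      (fun a _ b _ hab ↦ add_right_cancel hab)
      (fun u hu ↦ ⟨u - 1, mem_filter.2 ⟨mem_univ _, by simpa using (mem_filter.1 hu).2⟩, by simp⟩)
  have h2 : (returnSteps τ).card + ((verts τ).filter fun t ↦ τ (t + 1) = t + 1).card =
      (verts τ).card := by
    rw [add_comm, ← card_filter_add_card_filter_not (s := verts τ) fun t ↦ τ (t + 1) = t + 1]
    congr 2
    simp only [verts, returnSteps, filter_filter]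
  -- The last step wraps around to position 0, which is its own first visit; it accounts for the `+
  -- 1`.
  let z : Fin n := ⟨n - 1, by omega⟩
  have h3 : R ⊆ (verts τ).filter (fun t ↦ τ (t + 1) = t + 1) ∪ insert z (branchSteps τ) := by
    intro t ht
    have ht' : τ (t + 1) = t + 1 := (mem_filter.1 ht).2
    by_cases hf : τ t = t
    · exact mem_union_left _ (mem_filter.2 ⟨mem_filter.2 ⟨mem_univ _, hf⟩, ht'⟩)
    refine mem_union_right _ (mem_insert.2 ?_)
    by_cases hz : t = z
    · exact Or.inl hz
    refine Or.inr (mem_filter.2 ⟨mem_univ _, fun hc ↦ ?_⟩)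
    have hlt : τ t < t := lt_of_le_of_ne (h t).1 hf
    have htz : t < z := by
      refine lt_of_le_of_ne ?_ hz
      have := t.2
      exact Fin.le_def.2 (show (t : ℕ) ≤ n - 1 by omega)
    -- Without branching, the target would already have been seen at time `τ t + 1 < t + 1`.
    have h4 := Fin.le_def.1 (h (τ t + 1)).1
    rw [← hc, ht', val_add_one_of_lt' hlt, val_add_one_of_lt' htz] at h4
    have := Fin.lt_def.1 hlt
    omega
  have h4 := (card_le_card h3).trans (card_union_le _ _)
  have h5 := card_insert_le z (branchSteps τ)
  omega

/-- With n = 2L and v vertices this reads 4(L-v)+1, which vanishes up to 1 when every edge is as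
economical as possible. -/
theorem card_code_le (h : IsCanonical τ) (he : Even (wordEdges τ)) :
    (code τ).card + 4 * (verts τ).card ≤ 2 * n + 1 := by
  have h1 := h.card_branchSteps_le he
  have h2 := h.card_returnSteps_le
  have h3 : (code τ).card ≤ _ := card_image_le
  have h4 := card_union_le (branchSteps τ) (returnSteps τ)
  omega

/-- A canonical word is determined by its exceptional steps. -/
theorem eq_of_code_eq {τ' : Fin n → Fin n} (h : IsCanonical τ) (h' : IsCanonical τ')
    (hc : code τ = code τ') : τ = τ' := by
  have key : ∀ m (hm : m < n), τ ⟨m, hm⟩ = τ' ⟨m, hm⟩ := by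
    intro m
    induction m using Nat.strong_induction_on with
    | _ m ih =>
      intro hm
      obtain rfl | ⟨k, rfl⟩ : m = 0 ∨ ∃ k, m = k + 1 := by
        cases m with
        | zero => exact Or.inl rfl
        | succ k => exact Or.inr ⟨k, rfl⟩
      · have h0 : (⟨0, hm⟩ : Fin n) = 0 := Fin.ext (by simp)
        rw [h0, h.apply_zero, h'.apply_zero]
      let t : Fin n := ⟨k, by omega⟩
      have ht : (⟨k + 1, hm⟩ : Fin n) = t + 1 :=
        Fin.ext (val_add_one_of_lt' (s := t) (t := ⟨k + 1, hm⟩) (Nat.lt_succ_self k)).symm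
      have iht : τ t = τ' t := ih k (Nat.lt_succ_self k) _
      rw [ht]
      by_cases hex : t ∈ branchSteps τ ∪ returnSteps τ
      · have : (t, τ (t + 1)) ∈ code τ' := hc ▸ mem_code.2 ⟨hex, rfl⟩
        exact (mem_code.1 this).2.symm
      -- A non-exceptional step is forced by the past: a fresh vertex is left for a new one, a known
      -- vertex by its first exit.
      have hex' : t ∉ branchSteps τ' ∪ returnSteps τ' := fun hcon ↦ by
        have : (t, τ' (t + 1)) ∈ code τ := hc ▸ mem_code.2 ⟨hcon, rfl⟩
        exact hex (mem_code.1 this).1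
      simp only [branchSteps, returnSteps, mem_union, mem_filter, mem_univ, true_and, not_or,
        not_and, not_not] at hex hex'
      by_cases hf : τ t = t
      · rw [hex.2 hf, hex'.2 (iht ▸ hf)]
      · have hlt : τ t < t := lt_of_le_of_ne (h t).1 hf
        rw [hex.1, hex'.1, ← iht]
        have hval := val_add_one_of_lt' hlt
        have := ih (τ t + 1 : Fin n) (by rw [hval]; exact Nat.succ_lt_succ hlt) (τ t + 1).2
        exact this
  funext t
  exact key t t.2

/-- The sum over canonical words of a weight that decays with the number of exceptional steps. -/
theorem sum_pow_card_code_le (S : Finset (Fin n → Fin n)) (hS : ∀ τ ∈ S, IsCanonical τ)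
    {z : ℝ} (hz : 0 ≤ z) :
    ∑ τ ∈ S, z ^ (code τ).card ≤ (1 + z) ^ (n * n) := by
  have h1 : ∑ τ ∈ S, z ^ (code τ).card = ∑ E ∈ S.image code, z ^ E.card := by
    rw [sum_image]
    intro a ha b hb hab
    exact (hS a ha).eq_of_code_eq (hS b hb) hab
  -- Codes are distinct subsets of a set with n² elements, so the generating function of all subsets
  -- dominates.
  have h2 := Finset.sum_pow_mul_eq_add_pow z 1 (univ : Finset (Fin n × Fin n))
  simp only [one_pow, mul_one, card_univ, Fintype.card_prod, Fintype.card_fin] at h2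
  rw [h1, add_comm 1 z, ← h2]
  exact sum_le_sum_of_subset_of_nonneg (fun E _ ↦ mem_powerset.2 (subset_univ _))
    fun E _ _ ↦ pow_nonneg hz _

end IsCanonical

/-! ### Weights of paths and cycles. -/

section weights

open Finset
open scoped NNReal

variable {α V : Type*}

/-- The weight of a path. -/
def pathWeight (b : V → V → ℝ≥0) {m : ℕ} (f : Fin (m + 1) → V) : ℝ≥0 :=
  ∏ i : Fin m, b (f i.castSucc) (f i.succ)

/-- The weight of a closed path. -/
def cycleWeight (b : V → V → ℝ≥0) {m : ℕ} (f : Fin (m + 1) → V) : ℝ≥0 :=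
  ∏ i : Fin (m + 1), b (f i) (f (i + 1))

theorem prod_map_edges (b : V → V → ℝ≥0) (C : SimpleCycle V) :
    (C.edges.map fun e ↦ b e.1 e.2).prod = cycleWeight b C.toFun := by
  simp [SimpleCycle.edges, cycleWeight, Finset.prod, Function.comp_def]

/-- The sum of the weights of all simple cycles with `m + 1` edges. -/
noncomputable def cycleSum [Fintype V] [DecidableEq V] (b : V → V → ℝ≥0) (m : ℕ) : ℝ≥0 :=
  ∑ f : Fin (m + 1) → V with Function.Injective f, cycleWeight b f

/-- The sum of the weights of all simple paths with `m` edges. -/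
noncomputable def pathSum [Fintype V] [DecidableEq V] (b : V → V → ℝ≥0) (m : ℕ) : ℝ≥0 :=
  ∑ f : Fin (m + 1) → V with Function.Injective f, pathWeight b f

/-- The weight of an element of a family of closed paths, one of which, that with index `i₀`, lacks
its last edge. -/
def famWeight (b : V → V → ℝ≥0) {r : ℕ} (i₀ i : Fin r) {m : ℕ} (f : Fin (m + 1) → V) : ℝ≥0 :=
  if i = i₀ then pathWeight b f else cycleWeight b f

theorem famWeight_rpow (b : V → V → ℝ≥0) {r : ℕ} (i₀ i : Fin r) {m : ℕ} (f : Fin (m + 1) → V)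
    (p : ℝ) : famWeight b i₀ i f ^ p = famWeight (fun x y ↦ b x y ^ p) i₀ i f := by
  unfold famWeight pathWeight cycleWeight
  split_ifs <;> exact (NNReal.finsetProd_rpow _ _ _).symm

end weights

/-! ### Covering an even closed walk by simple cycles. -/

section decomposition

open Finset
open scoped NNReal

variable {n : ℕ} [NeZero n] {α : Type*}

/-- A family of cycles that covers an even closed walk has few members, compared with
the number of its edges that are not needed to reach the vertices of the walk. -/
theorem card_image_add_le [DecidableEq α] {w : Fin n → α} {r : ℕ} {C : Fin r → SimpleCycle α}
    (h : wordEdges w = ∑ i, (C i).edges + ∑ i, (C i).edges) :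
    (univ.image w).card + r ≤ ∑ i, ((C i).len + 1) + 1 := by
  classical
  let vs : Fin r → Finset α := fun i ↦ univ.image (C i).toFun
  have hvs : ∀ i, (vs i).card = (C i).len + 1 := fun i ↦ by
    simp [vs, card_image_of_injective _ (C i).inj]
  have hedge : ∀ t, ∃ i, (w t, w (t + 1)) ∈ (C i).edges := by
    intro t
    have : (w t, w (t + 1)) ∈ wordEdges w := mem_wordEdges.2 ⟨t, rfl⟩
    rw [h, Multiset.mem_add, or_self, Multiset.mem_sum] at this
    obtain ⟨i, -, hi⟩ := this
    exact ⟨i, hi⟩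
  have hsub : ∀ i, ∀ x ∈ vs i, ∃ t, w t = x := by
    intro i x hx
    obtain ⟨j, -, rfl⟩ := mem_image.1 hx
    have : ((C i).toFun j, (C i).toFun (j + 1)) ∈ wordEdges w := by
      rw [h, Multiset.mem_add, or_self, Multiset.mem_sum]
      exact ⟨i, mem_univ _, SimpleCycle.mem_edges.2 ⟨j, rfl⟩⟩
    obtain ⟨t, ht⟩ := mem_wordEdges.1 this
    exact ⟨t, (Prod.ext_iff.1 ht).1⟩
  have hverts : ∀ t i, (w t, w (t + 1)) ∈ (C i).edges → w t ∈ vs i ∧ w (t + 1) ∈ vs i := by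
    intro t i hi
    obtain ⟨j, hj⟩ := SimpleCycle.mem_edges.1 hi
    obtain ⟨h1, h2⟩ := Prod.ext_iff.1 hj
    exact ⟨mem_image.2 ⟨j, mem_univ _, h1⟩, mem_image.2 ⟨j + 1, mem_univ _, h2⟩⟩
  -- Cycles are added one at a time, each meeting the union of the earlier ones and so contributing
  -- at least one vertex fewer than its length. A maximal good subfamily turns out to be everything.
  let good : Finset (Finset (Fin r)) := univ.filter fun U ↦
    U.Nonempty ∧ (U.biUnion vs).card + U.card ≤ ∑ i ∈ U, ((C i).len + 1) + 1
  have hgood : good.Nonempty := by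
    obtain ⟨i, -⟩ := hedge 0
    refine ⟨{i}, mem_filter.2 ⟨mem_univ _, singleton_nonempty i, ?_⟩⟩
    rw [singleton_biUnion, sum_singleton, card_singleton, hvs]
  obtain ⟨U, hU, hmax⟩ := exists_max_image good card hgood
  obtain ⟨-, hne, hle⟩ := mem_filter.1 hU
  have huniv : U = univ := by
    by_contra hcon
    obtain ⟨i, hi⟩ : ∃ i, i ∉ U := by
      by_contra! hall
      exact hcon (eq_univ_of_forall hall)
    have hmeet : ∃ i, i ∉ U ∧ ∃ x ∈ vs i, x ∈ U.biUnion vs := by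
      by_contra! hno
      -- If no other cycle met the union, the walk could neither enter nor leave it, contradicting
      -- connectedness.
      have hstep : ∀ t, w t ∈ U.biUnion vs ↔ w (t + 1) ∈ U.biUnion vs := by
        intro t
        obtain ⟨j, hj⟩ := hedge t
        obtain ⟨h1, h2⟩ := hverts t j hj
        by_cases hjU : j ∈ U
        · exact ⟨fun _ ↦ mem_biUnion.2 ⟨j, hjU, h2⟩, fun _ ↦ mem_biUnion.2 ⟨j, hjU, h1⟩⟩
        · exact ⟨fun hh ↦ absurd hh (hno j hjU _ h1), fun hh ↦ absurd hh (hno j hjU _ h2)⟩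
      have hall : ∀ (m : ℕ) (hm : m < n), w ⟨m, hm⟩ ∈ U.biUnion vs ↔ w 0 ∈ U.biUnion vs := by
        intro m
        induction m with
        | zero => exact fun hm ↦ by rw [show (⟨0, hm⟩ : Fin n) = 0 from Fin.ext (by simp)]
        | succ m ih =>
          intro hm
          have := IsCanonical.val_add_one_of_lt' (s := ⟨m, by omega⟩) (t := ⟨m + 1, hm⟩)
            (Nat.lt_succ_self m)
          rw [show (⟨m + 1, hm⟩ : Fin n) = ⟨m, by omega⟩ + 1 from Fin.ext this.symm,
            ← hstep, ih]
      have hall' : ∀ t : Fin n, w t ∈ U.biUnion vs ↔ w 0 ∈ U.biUnion vs := fun t ↦ hall t t.2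
      obtain ⟨j, hj⟩ := hne
      obtain ⟨s, hs⟩ := hsub j ((C j).toFun 0) (mem_image_of_mem _ (mem_univ _))
      have h0 : w 0 ∈ U.biUnion vs := (hall' s).1 (hs ▸ mem_biUnion.2
        ⟨j, hj, mem_image_of_mem _ (mem_univ _)⟩)
      have hiv : (C i).toFun 0 ∈ vs i := mem_image_of_mem _ (mem_univ _)
      obtain ⟨t, ht⟩ := hsub i _ hiv
      exact hno i hi _ hiv (ht ▸ (hall' t).2 h0)
    obtain ⟨i, hi, x, hx, hxU⟩ := hmeet
    have hcard : (insert i U).card = U.card + 1 := card_insert_of_notMem hi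
    have hins : insert i U ∈ good := by
      refine mem_filter.2 ⟨mem_univ _, insert_nonempty _ _, ?_⟩
      rw [biUnion_insert, sum_insert hi, hcard]
      have h1 := card_union_add_card_inter (vs i) (U.biUnion vs)
      have h2 : 0 < (vs i ∩ U.biUnion vs).card := card_pos.2 ⟨x, mem_inter.2 ⟨hx, hxU⟩⟩
      have h3 := hvs i
      omega
    have := hmax _ hins
    omega
  subst huniv
  have himg : univ.image w ⊆ univ.biUnion vs := by
    intro x hx
    obtain ⟨t, -, rfl⟩ := mem_image.1 hx
    obtain ⟨i, hi⟩ := hedge t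
    exact mem_biUnion.2 ⟨i, mem_univ _, (hverts t i hi).1⟩
  have := card_le_card himg
  simp only [card_univ, Fintype.card_fin] at hle
  omega

/-- An even closed walk that makes the same step at two times is covered twice by
a family of simple cycles, in such a way that the two steps come from the last edge of a member. -/
theorem exists_cycle_family [Finite α] {w : Fin n → α} (he : Even (wordEdges w)) {s t : Fin n}
    (hst : s ≠ t) (h1 : w s = w t) (h2 : w (s + 1) = w (t + 1)) :
    ∃ (r : ℕ) (C : Fin r → SimpleCycle α) (i₀ : Fin r),
      wordEdges w = ∑ i, (C i).edges + ∑ i, (C i).edges ∧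
      ∀ b : α → α → ℝ≥0, ∏ u ∈ univ.filter (fun u ↦ u ≠ s ∧ u ≠ t), b (w u) (w (u + 1)) =
        (∏ i, famWeight b i₀ i (C i).toFun) ^ 2 := by
  classical
  obtain ⟨H, hH⟩ := he
  have hbal : H.map Prod.fst = H.map Prod.snd := by
    have := map_fst_wordEdges w
    rw [hH, Multiset.map_add, Multiset.map_add] at this
    ext x
    have := congrArg (Multiset.count x) this
    rw [Multiset.count_add, Multiset.count_add] at this
    omega
  obtain ⟨r, D, hD⟩ := SimpleCycle.exists_decomposition H hbal
  have hmem : (w s, w (s + 1)) ∈ H := by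
    have : (w s, w (s + 1)) ∈ wordEdges w := mem_wordEdges.2 ⟨s, rfl⟩
    rwa [hH, Multiset.mem_add, or_self] at this
  obtain ⟨i₀, -, hi₀⟩ := Multiset.mem_sum.1 (hD ▸ hmem)
  obtain ⟨E, hE, hEl, hE0⟩ := SimpleCycle.exists_rotate hi₀
  -- The cycle containing the repeated edge is rotated so that this edge comes last; deleting one
  -- copy of it from the half `H` leaves a path.
  let C : Fin r → SimpleCycle α := Function.update D i₀ E
  have hCD : ∀ i, (C i).edges = (D i).edges := by
    intro i
    by_cases hi : i = i₀
    · subst hi; simp [C, hE]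
    · simp [C, hi]
  have hHC : H = ∑ i, (C i).edges := by rw [hD]; exact sum_congr rfl fun i _ ↦ (hCD i).symm
  refine ⟨r, C, i₀, by rw [← hHC, hH], fun b ↦ ?_⟩
  have hCi : C i₀ = E := by simp [C]
  -- the two steps are removed from both sides of the equation between multisets of edges
  have hJ : ∃ H', H = (w s, w (s + 1)) ::ₘ H' ∧
      ∀ b : α → α → ℝ≥0, (H'.map fun e ↦ b e.1 e.2).prod = ∏ i, famWeight b i₀ i (C i).toFun := by
    let P : Multiset (α × α) :=
      (univ : Finset (Fin E.len)).val.map fun i ↦ (E.toFun i.castSucc, E.toFun i.succ)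
    have hP : E.edges = (w s, w (s + 1)) ::ₘ P := by
      rw [SimpleCycle.edges, Fin.univ_castSuccEmb, cons_val, Multiset.map_cons, map_val,
        Multiset.map_map, Fin.last_add_one, hEl, hE0]
      simp [P, Function.comp_def]
    refine ⟨P + ∑ i ∈ univ.erase i₀, (C i).edges, ?_, fun b ↦ ?_⟩
    · rw [hHC, ← add_sum_erase _ _ (mem_univ i₀), hCi, hP, Multiset.cons_add]
    · rw [Multiset.map_add, Multiset.prod_add, ← mul_prod_erase _ _ (mem_univ i₀)]
      congr 1
      · rw [famWeight, if_pos rfl, hCi]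
        simp [P, pathWeight, Finset.prod, Function.comp_def]
      · have := map_sum (Multiset.mapAddMonoidHom fun e : α × α ↦ b e.1 e.2)
          (fun i ↦ (C i).edges) (univ.erase i₀)
        rw [Multiset.coe_mapAddMonoidHom] at this
        rw [this, Multiset.prod_sum]
        refine prod_congr rfl fun i hi ↦ ?_
        rw [famWeight, if_neg (ne_of_mem_erase hi)]
        exact prod_map_edges b (C i)
  obtain ⟨H', hH', hprod⟩ := hJ
  have hT : (univ.filter (fun u ↦ u ≠ s ∧ u ≠ t)).val.map (fun u ↦ (w u, w (u + 1))) = H' + H' := by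
    have huniv : (univ : Finset (Fin n)) =
        insert s (insert t (univ.filter (fun u ↦ u ≠ s ∧ u ≠ t))) := by
      ext u; simp; tauto
    have h3 : wordEdges w = (w s, w (s + 1)) ::ₘ (w s, w (s + 1)) ::ₘ
        (univ.filter (fun u ↦ u ≠ s ∧ u ≠ t)).val.map (fun u ↦ (w u, w (u + 1))) := by
      rw [wordEdges]
      conv_lhs => rw [huniv]
      rw [insert_val_of_notMem (by simp [hst]), insert_val_of_notMem (by simp), Multiset.map_cons,
        Multiset.map_cons, ← h1, ← h2]
    rw [hH, hH', Multiset.cons_add, Multiset.add_cons] at h3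
    simpa using h3.symm
  rw [← hprod b, sq, ← Multiset.prod_add, ← Multiset.map_add, ← hT, Multiset.map_map]
  rfl

end decomposition

/-! ### Total weight of the even words. -/

section patternClass

open Finset
open scoped NNReal

variable {n : ℕ} [NeZero n] {V : Type*} [Fintype V] [DecidableEq V]

/-- The words with a given pattern. -/
noncomputable def patternClass (V : Type*) [Fintype V] [DecidableEq V] (τ : Fin n → Fin n) :
    Finset (Fin n → V) :=
  univ.filter fun w ↦ canon w = τ

theorem comp_of_mem_patternClass {τ : Fin n → Fin n} {w : Fin n → V}
    (hw : w ∈ patternClass V τ) : w ∘ τ = w := by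
  obtain rfl := (mem_filter.1 hw).2
  exact funext fun t ↦ apply_canon w t

theorem card_patternClass_le (τ : Fin n → Fin n) :
    (patternClass V τ).card ≤ Fintype.card V ^ (univ.image τ).card := by
  have h : (patternClass V τ).card ≤ (univ : Finset ((univ.image τ) → V)).card := by
    refine card_le_card_of_injOn (fun w u ↦ w u) (fun _ _ ↦ mem_coe.2 (mem_univ _)) ?_
    intro w hw w' hw' h
    rw [← comp_of_mem_patternClass (mem_coe.1 hw), ← comp_of_mem_patternClass (mem_coe.1 hw')]
    funext t
    exact congrFun h ⟨τ t, mem_image_of_mem _ (mem_univ _)⟩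
  rwa [card_univ, Fintype.card_fun, Fintype.card_coe] at h

/-- Sums over the words with a given pattern decouple over a covering family of cycles. -/
theorem sum_patternClass_prod_le {τ : Fin n → Fin n} {r : ℕ}
    {C : Fin r → SimpleCycle (Fin n)}
    (hC : wordEdges τ = ∑ i, (C i).edges + ∑ i, (C i).edges)
    (F : ∀ i, (Fin ((C i).len + 1) → V) → ℝ≥0) :
    ∑ w ∈ patternClass V τ, ∏ i, F i (w ∘ (C i).toFun) ≤
      ∏ i, ∑ f : Fin ((C i).len + 1) → V with Function.Injective f, F i f := by
  have hmem : ∀ i j, (C i).toFun j ∈ univ.image τ := by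
    intro i j
    have : ((C i).toFun j, (C i).toFun (j + 1)) ∈ wordEdges τ := by
      rw [hC, Multiset.mem_add, or_self, Multiset.mem_sum]
      exact ⟨i, mem_univ _, SimpleCycle.mem_edges.2 ⟨j, rfl⟩⟩
    obtain ⟨t, ht⟩ := mem_wordEdges.1 this
    exact mem_image.2 ⟨t, mem_univ _, (Prod.ext_iff.1 ht).1⟩
  have hcover : ∀ t, ∃ i j, (C i).toFun j = τ t := by
    intro t
    have : (τ t, τ (t + 1)) ∈ wordEdges τ := mem_wordEdges.2 ⟨t, rfl⟩
    rw [hC, Multiset.mem_add, or_self, Multiset.mem_sum] at this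
    obtain ⟨i, -, hi⟩ := this
    obtain ⟨j, hj⟩ := SimpleCycle.mem_edges.1 hi
    exact ⟨i, j, (Prod.ext_iff.1 hj).1⟩
  let Φ : (Fin n → V) → ∀ i, Fin ((C i).len + 1) → V := fun w i ↦ w ∘ (C i).toFun
  have hinj : Set.InjOn Φ (patternClass V τ) := by
    intro w hw w' hw' h
    rw [← comp_of_mem_patternClass (mem_coe.1 hw), ← comp_of_mem_patternClass (mem_coe.1 hw')]
    funext t
    obtain ⟨i, j, hij⟩ := hcover t
    simpa [Φ, hij] using congrFun (congrFun h i) j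
  -- A word of this pattern is recovered from its restrictions to the cycles, each of which is
  -- injective. Passing to all tuples of injective words drops the coincidences between cycles and
  -- only adds nonnegative terms.
  rw [prod_univ_sum]
  calc ∑ w ∈ patternClass V τ, ∏ i, F i (w ∘ (C i).toFun)
      = ∑ p ∈ (patternClass V τ).image Φ, ∏ i, F i (p i) :=
        (sum_image (f := fun p ↦ ∏ i, F i (p i)) hinj).symm
    _ ≤ _ := by
      refine sum_le_sum_of_subset fun p hp ↦ ?_
      obtain ⟨w, hw, rfl⟩ := mem_image.1 hp
      refine Fintype.mem_piFinset.2 fun i ↦ mem_filter.2 ⟨mem_univ _, ?_⟩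
      intro a b hab
      refine (C i).inj ?_
      have h1 : canon w = τ := (mem_filter.1 hw).2
      obtain ⟨s, -, hs⟩ := mem_image.1 (hmem i a)
      obtain ⟨t, -, ht⟩ := mem_image.1 (hmem i b)
      have hws : ∀ s, w (τ s) = w s := congrFun (comp_of_mem_patternClass hw)
      change w ((C i).toFun a) = w ((C i).toFun b) at hab
      rw [← hs, ← ht, hws, hws] at hab
      rw [← hs, ← ht, ← h1, canon, canon, hab]

/-- The weight of a word, the steps at times `s` and `t` being left out. -/
def wordWeight (a : V → V → ℝ≥0) (s t : Fin n) (w : Fin n → V) : ℝ≥0 :=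
  ∏ u ∈ univ.filter (fun u ↦ u ≠ s ∧ u ≠ t), a (w u) (w (u + 1))

/-- Canonical words that may be the pattern of an even word with equal steps at times `s`, `t`. -/
noncomputable def evenPatterns (s t : Fin n) : Finset (Fin n → Fin n) := by
  classical
  exact univ.filter fun τ ↦ IsCanonical τ ∧ Even (wordEdges τ) ∧ τ s = τ t ∧ τ (s + 1) = τ (t + 1)

/-- Where `x` exceeds `y`, the factor `(x / y) ^ η` is at least 1. This trades a first moment for a
`1 + η` moment plus a counting term. -/
theorem le_rpow_mul_rpow_add {x y : ℝ≥0} (hy : 0 < y) {η : ℝ} (hη : 0 < η) :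
    x ≤ y ^ (-η) * x ^ (1 + η) + y := by
  rcases le_total x y with h | h
  · exact h.trans le_add_self
  · refine le_add_right ?_
    have hx : x ≠ 0 := (hy.trans_le h).ne'
    rw [NNReal.rpow_add hx, NNReal.rpow_one, NNReal.rpow_neg]
    have h1 : y ^ η ≤ x ^ η := NNReal.rpow_le_rpow h hη.le
    have h2 : 0 < y ^ η := NNReal.rpow_pos hy
    calc x = (y ^ η)⁻¹ * (x * y ^ η) := by field_simp
      _ ≤ _ := by gcongr

/-- The truncation hypothesis: the weights of short cycles and paths are not too large. -/
def CycleBound (b : V → V → ℝ≥0) (K M : ℝ≥0) (L : ℕ) : Prop :=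
  ∀ m < L, cycleSum b m ≤ K * M ^ (m + 1) ∧ pathSum b m ≤ K * M ^ (m + 1)

/-- Decoupling gives one factor `K` per cycle, and connectedness bounds the number of cycles; the
powers of `M` add up to the total length `L`. -/
theorem sum_wordWeight_rpow_le {a : V → V → ℝ≥0} {K M : ℝ≥0} {L : ℕ} (hn : n = 2 * L)
    (hK : 1 ≤ K) {η : ℝ} (hb : CycleBound (fun x y ↦ a x y ^ (2 * (1 + η))) K M L) {s t : Fin n}
    (hst : s ≠ t) {τ : Fin n → Fin n} (hτ : τ ∈ evenPatterns s t) :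
    (univ.image τ).card ≤ L ∧
    ∑ w ∈ patternClass V τ, wordWeight a s t w ^ (1 + η) ≤
      K ^ (L - (univ.image τ).card + 1) * M ^ L := by
  classical
  obtain ⟨-, he, h1, h2⟩ := (mem_filter.1 hτ).2
  obtain ⟨r, C, i₀, hC, hprod⟩ := exists_cycle_family he hst h1 h2
  have hlen : ∑ i, ((C i).len + 1) = L := by
    have := congrArg Multiset.card hC
    rw [card_wordEdges, Multiset.card_add, Multiset.card_sum] at this
    simp only [SimpleCycle.card_edges] at this
    omega
  have hcard := card_image_add_le hC
  rw [hlen] at hcard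
  have hr : 0 < r := i₀.pos
  refine ⟨by omega, ?_⟩
  let b : V → V → ℝ≥0 := fun x y ↦ a x y ^ (2 * (1 + η))
  have hw : ∀ w ∈ patternClass V τ, wordWeight a s t w ^ (1 + η) =
      ∏ i, famWeight b i₀ i (w ∘ (C i).toFun) := by
    intro w hw
    have h3 : wordWeight a s t w = (∏ i, famWeight a i₀ i (w ∘ (C i).toFun)) ^ 2 := by
      have := hprod fun x y ↦ a (w x) (w y)
      have hws : ∀ s, w (τ s) = w s := congrFun (comp_of_mem_patternClass hw)
      simp only [hws] at this
      exact this
    rw [h3, ← NNReal.rpow_natCast, ← NNReal.rpow_mul, ← NNReal.finsetProd_rpow]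
    simp only [famWeight_rpow]
    rfl
  rw [sum_congr rfl hw]
  refine (sum_patternClass_prod_le hC fun i ↦ famWeight b i₀ i).trans ?_
  have hi : ∀ i, ∑ f : Fin ((C i).len + 1) → V with Function.Injective f, famWeight b i₀ i f ≤
      K * M ^ ((C i).len + 1) := by
    intro i
    have hiL : (C i).len < L := by
      have := single_le_sum (f := fun i ↦ (C i).len + 1) (fun _ _ ↦ Nat.zero_le _) (mem_univ i)
      omega
    unfold famWeight
    split_ifs
    · exact (hb _ hiL).2
    · exact (hb _ hiL).1
  refine (prod_le_prod' fun i _ ↦ hi i).trans ?_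
  rw [prod_mul_distrib, prod_const, prod_pow_eq_pow_sum, hlen, card_univ, Fintype.card_fin]
  gcongr ?_ * _
  exact pow_le_pow_right₀ hK (by omega)

theorem sum_wordWeight_le {a : V → V → ℝ≥0} {K β : ℝ≥0} {L : ℕ} (hn : n = 2 * L) [Nonempty V]
    (hK : 1 ≤ K) (hβ : 1 ≤ β) {η : ℝ} (hη : 0 < η)
    (hb : CycleBound (fun x y ↦ a x y ^ (2 * (1 + η))) K (Fintype.card V * β) L) {s t : Fin n}
    (hst : s ≠ t) {τ : Fin n → Fin n} (hτ : τ ∈ evenPatterns s t) :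
    ∑ w ∈ patternClass V τ, wordWeight a s t w ≤
      2 * K * (Fintype.card V * β) ^ L *
        (K * (Fintype.card V : ℝ≥0) ^ (-(η / (1 + η)))) ^ (L - (univ.image τ).card) := by
  classical
  obtain ⟨hv, hsum⟩ := sum_wordWeight_rpow_le hn hK hb hst hτ
  have hcl := card_patternClass_le (V := V) τ
  obtain ⟨g, hg⟩ := Nat.exists_eq_add_of_le hv
  set v := (univ.image τ).card
  have hgv : L - v = g := by omega
  rw [hgv] at hsum ⊢
  set N : ℝ≥0 := (Fintype.card V : ℝ≥0) with hNdef
  have hN : 0 < N := by rw [hNdef]; exact_mod_cast Fintype.card_pos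
  -- This threshold gives the moment term and the counting term the same gain in `N`.
  set y : ℝ≥0 := N ^ ((g : ℝ) / (1 + η)) with hy
  have hη1 : 1 + η ≠ 0 := by positivity
  have hypos : 0 < y := NNReal.rpow_pos hN
  have hy1 : y ^ (-η) = (N ^ (-(η / (1 + η)))) ^ g := by
    rw [hy, ← NNReal.rpow_mul, ← NNReal.rpow_natCast, ← NNReal.rpow_mul]
    congr 1
    field_simp
  have hy2 : y * N ^ v = N ^ L * (N ^ (-(η / (1 + η)))) ^ g := by
    rw [hy, ← NNReal.rpow_natCast, ← NNReal.rpow_natCast, ← NNReal.rpow_natCast,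
      ← NNReal.rpow_mul, ← NNReal.rpow_add hN.ne', ← NNReal.rpow_add hN.ne', hg]
    congr 1
    push_cast
    field_simp
    ring
  calc ∑ w ∈ patternClass V τ, wordWeight a s t w
      ≤ ∑ w ∈ patternClass V τ, (y ^ (-η) * wordWeight a s t w ^ (1 + η) + y) :=
        sum_le_sum fun w _ ↦ le_rpow_mul_rpow_add hypos hη
    _ = y ^ (-η) * ∑ w ∈ patternClass V τ, wordWeight a s t w ^ (1 + η) +
        y * (patternClass V τ).card := by
      rw [sum_add_distrib, ← mul_sum, sum_const, nsmul_eq_mul, mul_comm y]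
    _ ≤ y ^ (-η) * (K ^ (g + 1) * (N * β) ^ L) + y * N ^ v := by
      gcongr
      rw [hNdef]
      exact_mod_cast hcl
    _ ≤ K * (N * β) ^ L * (K * N ^ (-(η / (1 + η)))) ^ g +
        K * (N * β) ^ L * (K * N ^ (-(η / (1 + η)))) ^ g := by
      gcongr ?_ + ?_
      · rw [hy1, mul_pow K]
        exact le_of_eq (by ring)
      · rw [hy2, mul_pow K]
        have h1 : N ^ L ≤ K * (N * β) ^ L := by
          calc N ^ L = 1 * (N * 1) ^ L := by ring
            _ ≤ _ := by gcongr
        have h2 : (N ^ (-(η / (1 + η)))) ^ g ≤ K ^ g * (N ^ (-(η / (1 + η)))) ^ g :=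
          le_mul_of_one_le_left zero_le (one_le_pow₀ hK)
        exact mul_le_mul' h1 h2
    _ = _ := by ring

/-- The total weight of the even words, under the truncation hypothesis. -/
theorem sum_even_wordWeight_le {a : V → V → ℝ≥0} {K β : ℝ≥0} {L : ℕ} (hn : n = 2 * L)
    [Nonempty V] (hK : 1 ≤ K) (hβ : 1 ≤ β) {η : ℝ} (hη : 0 < η)
    (hb : CycleBound (fun x y ↦ a x y ^ (2 * (1 + η))) K (Fintype.card V * β) L) {s t : Fin n}
    (hst : s ≠ t)
    (hKN : K * (Fintype.card V : ℝ≥0) ^ (-(η / (1 + η))) ≤ (((n : ℝ≥0) ^ 2)⁻¹) ^ 4)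
    (S : Finset (Fin n → V))
    (hS : ∀ w ∈ S, Even (wordEdges w) ∧ w s = w t ∧ w (s + 1) = w (t + 1)) :
    ∑ w ∈ S, wordWeight a s t w ≤ 6 * K * n ^ 2 * (Fintype.card V * β) ^ L := by
  classical
  have hn1 : (1 : ℝ≥0) ≤ n := by
    exact_mod_cast Nat.one_le_iff_ne_zero.2 (NeZero.ne n)
  -- With this `z` the sum over codes is at most (1 + n⁻²)^(n²) ≤ e. Each unit of L-v pays for four
  -- exceptional steps; the one left over costs a factor n².
  set z : ℝ≥0 := ((n : ℝ≥0) ^ 2)⁻¹ with hz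
  have hz0 : 0 < z := by positivity
  have hz1 : z ≤ 1 := inv_le_one_of_one_le₀ (one_le_pow₀ hn1)
  have hstep : ∀ τ ∈ evenPatterns s t, z * ∑ w ∈ patternClass V τ, wordWeight a s t w ≤
      2 * K * (Fintype.card V * β) ^ L * z ^ (IsCanonical.code τ).card := by
    intro τ hτ
    have hτ' := (mem_filter.1 hτ).2
    have h1 := sum_wordWeight_le hn hK hβ hη hb hst hτ
    have h2 := hτ'.1.card_code_le hτ'.2.1
    rw [← hτ'.1.image_eq_verts] at h2
    calc z * ∑ w ∈ patternClass V τ, wordWeight a s t w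
        ≤ z * (2 * K * (Fintype.card V * β) ^ L * (z ^ 4) ^ (L - (univ.image τ).card)) := by
          gcongr
          refine h1.trans ?_
          gcongr
      _ = 2 * K * (Fintype.card V * β) ^ L * z ^ (4 * (L - (univ.image τ).card) + 1) := by ring
      _ ≤ _ := by
        exact mul_le_mul' le_rfl (pow_le_pow_of_le_one zero_le hz1 (by omega))
  have hcode : ∑ τ ∈ evenPatterns s t, z ^ (IsCanonical.code τ).card ≤ 3 := by
    have h1 := IsCanonical.sum_pow_card_code_le (evenPatterns s t)
      (fun τ hτ ↦ (mem_filter.1 hτ).2.1) z.coe_nonneg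
    have h2 : (1 + (z : ℝ)) ^ (n * n) ≤ 3 := by
      calc (1 + (z : ℝ)) ^ (n * n) ≤ Real.exp z ^ (n * n) := by
            gcongr
            rw [add_comm]
            exact Real.add_one_le_exp _
        _ = Real.exp 1 := by
          rw [← Real.exp_nat_mul, hz]
          congr 1
          push_cast
          have : (n : ℝ) ≠ 0 := Nat.cast_ne_zero.2 (NeZero.ne n)
          field_simp
        _ ≤ 3 := Real.exp_one_lt_three.le
    exact_mod_cast h1.trans h2
  have hsum : ∑ w ∈ S, wordWeight a s t w ≤
      ∑ τ ∈ evenPatterns s t, ∑ w ∈ patternClass V τ, wordWeight a s t w := by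
    rw [← sum_biUnion]
    · refine sum_le_sum_of_subset fun w hw ↦ ?_
      obtain ⟨h1, h2, h3⟩ := hS w hw
      refine mem_biUnion.2 ⟨canon w, mem_filter.2 ⟨mem_univ _, isCanonical_canon w,
        even_wordEdges_canon h1, ?_, ?_⟩, mem_filter.2 ⟨mem_univ _, rfl⟩⟩
      · rw [canon, canon, h2]
      · rw [canon, canon, h3]
    · intro τ _ τ' _ hne
      refine disjoint_left.2 fun w hw hw' ↦ hne ?_
      rw [← (mem_filter.1 hw).2, ← (mem_filter.1 hw').2]
  have hfin : z * ∑ w ∈ S, wordWeight a s t w ≤ 2 * K * (Fintype.card V * β) ^ L * 3 := by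
    calc z * ∑ w ∈ S, wordWeight a s t w
        ≤ z * ∑ τ ∈ evenPatterns s t, ∑ w ∈ patternClass V τ, wordWeight a s t w := by gcongr
      _ ≤ ∑ τ ∈ evenPatterns s t, 2 * K * (Fintype.card V * β) ^ L *
          z ^ (IsCanonical.code τ).card := by
        rw [mul_sum]
        exact sum_le_sum hstep
      _ ≤ _ := by
        rw [← mul_sum]
        gcongr
  calc ∑ w ∈ S, wordWeight a s t w = n ^ 2 * (z * ∑ w ∈ S, wordWeight a s t w) := by
        rw [hz, ← mul_assoc, mul_inv_cancel₀ (by positivity), one_mul]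
    _ ≤ n ^ 2 * (2 * K * (Fintype.card V * β) ^ L * 3) := by gcongr
    _ = _ := by ring

end patternClass

/-! ### Frobenius norm of powers and averaging over signs. -/

section signs

open Finset
open scoped NNReal ComplexConjugate

variable {V : Type*} [Fintype V] [DecidableEq V]

/-- The entries of the powers of a matrix as sums over walks. -/
theorem pow_apply_eq_sum_walks {R : Type*} [CommSemiring R] (A : Matrix V V R) (k : ℕ) (i j : V) :
    (A ^ k) i j = ∑ p : Fin (k + 1) → V,
      if p 0 = i ∧ p (Fin.last k) = j then ∏ t : Fin k, A (p t.castSucc) (p t.succ) else 0 := by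
  induction k generalizing i with
  | zero =>
    rw [pow_zero, Matrix.one_apply, ← (Equiv.funUnique (Fin 1) V).symm.sum_comp]
    simp only [Fin.last_zero, univ_eq_empty, prod_empty]
    have : ∀ x : V, (Equiv.funUnique (Fin 1) V).symm x 0 = x := fun x ↦ rfl
    simp only [this]
    by_cases h : i = j
    · subst h; simp
    · rw [if_neg h, sum_eq_zero]
      intro x _
      rw [if_neg]
      rintro ⟨rfl, h'⟩
      exact h h'
  | succ k ih =>
    rw [pow_succ', Matrix.mul_apply, ← (Fin.consEquiv fun _ : Fin (k + 2) ↦ V).sum_comp,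
      Fintype.sum_prod_type]
    have h1 : ∀ x, A i x * (A ^ k) x j = ∑ p : Fin (k + 1) → V,
        if p 0 = x ∧ p (Fin.last k) = j then
          A i (p 0) * ∏ t : Fin k, A (p t.castSucc) (p t.succ) else 0 := by
      intro x
      rw [ih, mul_sum]
      refine sum_congr rfl fun p _ ↦ ?_
      rw [mul_ite, mul_zero]
      refine if_ctx_congr Iff.rfl (fun h ↦ by rw [h.1]) fun _ ↦ rfl
    simp only [h1]
    rw [sum_comm, sum_comm (s := (univ : Finset V))]
    refine sum_congr rfl fun p _ ↦ ?_
    have h2 : ∀ x : V, (Fin.consEquiv fun _ : Fin (k + 2) ↦ V) (x, p) = Fin.cons x p :=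
      fun _ ↦ rfl
    have h3 : ∀ x : V, (Fin.cons x p : Fin (k + 2) → V) (Fin.last (k + 1)) = p (Fin.last k) :=
      fun x ↦ by rw [← Fin.succ_last, Fin.cons_succ]
    simp only [h2, h3, Fin.cons_zero, Fin.prod_univ_succ, Fin.cons_succ, Fin.castSucc_zero,
      ← Fin.succ_castSucc]
    by_cases hj : p (Fin.last k) = j <;> simp [hj]

/-- The two halves of a word have the same endpoints. -/
def SameEnds {V : Type*} {k : ℕ} (w : Fin ((k + 1) + (k + 1)) → V) : Prop :=
  w (Fin.castAdd _ 0) = w (Fin.natAdd _ 0) ∧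
    w (Fin.castAdd _ (Fin.last k)) = w (Fin.natAdd _ (Fin.last k))

instance {k : ℕ} (w : Fin ((k + 1) + (k + 1)) → V) : Decidable (SameEnds w) :=
  inferInstanceAs (Decidable (_ ∧ _))

/-- The product of the entries along the first half of a word and of the conjugate entries along
the second half. -/
def halvesProd {V : Type*} (A : Matrix V V ℂ) {k : ℕ} (w : Fin ((k + 1) + (k + 1)) → V) : ℂ :=
  (∏ t : Fin k, A (w (Fin.castAdd _ t.castSucc)) (w (Fin.castAdd _ t.succ))) *
    ∏ t : Fin k, conj (A (w (Fin.natAdd _ t.castSucc)) (w (Fin.natAdd _ t.succ)))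

theorem sum_norm_sq_pow_apply (A : Matrix V V ℂ) (k : ℕ) :
    ((∑ i, ∑ j, ‖(A ^ k) i j‖ ^ 2 : ℝ) : ℂ) =
      ∑ w : Fin ((k + 1) + (k + 1)) → V with SameEnds w, halvesProd A w := by
  push_cast
  have h : ∀ i j, ((‖(A ^ k) i j‖ : ℂ)) ^ 2 = ∑ p : Fin (k + 1) → V, ∑ q : Fin (k + 1) → V,
      if p 0 = i ∧ p (Fin.last k) = j then
        if q 0 = i ∧ q (Fin.last k) = j then
        (∏ t : Fin k, A (p t.castSucc) (p t.succ)) *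
          ∏ t : Fin k, conj (A (q t.castSucc) (q t.succ)) else 0 else 0 := by
    intro i j
    rw [← Complex.mul_conj', pow_apply_eq_sum_walks, map_sum, sum_mul_sum]
    refine sum_congr rfl fun p _ ↦ sum_congr rfl fun q _ ↦ ?_
    rw [apply_ite conj, map_prod, map_zero]
    split_ifs <;> simp
  simp only [h]
  rw [sum_filter, ← (Fin.appendEquiv (α := V) (k + 1) (k + 1)).sum_comp, Fintype.sum_prod_type]
  have hl : ∀ (p q : Fin (k + 1) → V) t,
      Fin.appendEquiv (α := V) (k + 1) (k + 1) (p, q) (Fin.castAdd _ t) = p t :=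
    fun p q t ↦ Fin.append_left p q t
  have hr : ∀ (p q : Fin (k + 1) → V) t,
      Fin.appendEquiv (α := V) (k + 1) (k + 1) (p, q) (Fin.natAdd _ t) = q t :=
    fun p q t ↦ Fin.append_right p q t
  simp only [SameEnds, halvesProd, hl, hr]
  rw [sum_congr rfl fun i _ ↦ sum_comm, sum_comm]
  refine sum_congr rfl fun p _ ↦ ?_
  rw [sum_congr rfl fun i _ ↦ sum_comm, sum_comm]
  refine sum_congr rfl fun q _ ↦ ?_
  rw [sum_eq_single (p 0), sum_eq_single (p (Fin.last k))]
  · simp only [and_self, if_true, eq_comm]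
  · intro j _ hj
    rw [if_neg]
    exact fun h ↦ hj h.2.symm
  · simp
  · intro i _ hi
    refine sum_eq_zero fun j _ ↦ if_neg fun h ↦ hi h.1.symm
  · simp

theorem neZero_add_self (k : ℕ) : NeZero ((k + 1) + (k + 1)) := ⟨by omega⟩

attribute [local instance] neZero_add_self

/-- The two omitted positions are the closing steps, from the end of each half to the start of the
other. -/
theorem prod_halves {V M : Type*} [CommMonoid M] {k : ℕ} (φ : V → V → M)
    (w : Fin ((k + 1) + (k + 1)) → V) :
    ∏ u ∈ univ.filter (fun u ↦ u ≠ Fin.castAdd (k + 1) (Fin.last k) ∧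
        u ≠ Fin.natAdd (k + 1) (Fin.last k)), φ (w u) (w (u + 1)) =
      (∏ t : Fin k, φ (w (Fin.castAdd _ t.castSucc)) (w (Fin.castAdd _ t.succ))) *
        ∏ t : Fin k, φ (w (Fin.natAdd _ t.castSucc)) (w (Fin.natAdd _ t.succ)) := by
  have hl : ∀ t : Fin k, (Fin.castAdd (k + 1) t.castSucc + 1 : Fin ((k + 1) + (k + 1))) =
      Fin.castAdd (k + 1) t.succ := fun t ↦ by
    refine Fin.ext ?_
    rw [IsCanonical.val_add_one_of_lt' (t := Fin.castAdd (k + 1) t.succ)]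
    · simp
    · exact Fin.lt_def.2 (by simp)
  have hr : ∀ t : Fin k, (Fin.natAdd (k + 1) t.castSucc + 1 : Fin ((k + 1) + (k + 1))) =
      Fin.natAdd (k + 1) t.succ := fun t ↦ by
    refine Fin.ext ?_
    rw [IsCanonical.val_add_one_of_lt' (t := Fin.natAdd (k + 1) t.succ)]
    · simp only [Fin.val_natAdd, Fin.val_castSucc, Fin.val_succ, add_assoc]
    · exact Fin.lt_def.2 (by simp)
  rw [prod_filter, Fin.prod_univ_add, Fin.prod_univ_castSucc, Fin.prod_univ_castSucc]
  rw [if_neg (by simp), if_neg (by simp), mul_one, mul_one]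
  congr 1
  · refine prod_congr rfl fun t _ ↦ ?_
    rw [if_pos, hl]
    have := t.2
    constructor <;> exact fun h ↦ by have := Fin.ext_iff.1 h; simp at this; omega
  · refine prod_congr rfl fun t _ ↦ ?_
    rw [if_pos, hr]
    have := t.2
    constructor <;> exact fun h ↦ by have := Fin.ext_iff.1 h; simp at this; omega

theorem castAdd_last_add_one (k : ℕ) :
    (Fin.castAdd (k + 1) (Fin.last k) + 1 : Fin ((k + 1) + (k + 1))) = Fin.natAdd (k + 1) 0 := by
  refine Fin.ext ?_
  rw [IsCanonical.val_add_one_of_lt' (t := Fin.natAdd (k + 1) 0)]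
  · simp
  · exact Fin.lt_def.2 (by simp)

theorem natAdd_last_add_one (k : ℕ) :
    (Fin.natAdd (k + 1) (Fin.last k) + 1 : Fin ((k + 1) + (k + 1))) = Fin.castAdd (k + 1) 0 := by
  refine Fin.ext ?_
  rw [Fin.val_add, Fin.val_one', Nat.add_mod_mod]
  have : ((Fin.natAdd (k + 1) (Fin.last k) : Fin ((k + 1) + (k + 1))) : ℕ) + 1 =
      (k + 1) + (k + 1) := by simp [add_assoc]
  rw [this, Nat.mod_self]
  simp

/-- Summing a product of signs over all choices of signs keeps only the even products. -/
theorem sum_signs_prod {ι : Type*} [Fintype ι] [DecidableEq ι] (M : Multiset ι)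
    [Decidable (Even M)] :
    ∑ s : ι → ℤˣ, (M.map fun e ↦ ((s e : ℤ) : ℂ)).prod =
      if Even M then (Fintype.card (ι → ℤˣ) : ℂ) else 0 := by
  have h1 : ∀ s : ι → ℤˣ, (M.map fun e ↦ ((s e : ℤ) : ℂ)).prod =
      ∏ e, ((s e : ℤ) : ℂ) ^ M.count e := by
    intro s
    rw [Finset.prod_multiset_map_count]
    refine prod_subset (subset_univ _) fun e _ he ↦ ?_
    rw [Multiset.count_eq_zero_of_notMem (by simpa using he), pow_zero]
  have h2 : ∀ c : ℕ, ∑ u : ℤˣ, ((u : ℤ) : ℂ) ^ c = if Even c then 2 else 0 := by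
    intro c
    have : (univ : Finset ℤˣ) = {1, -1} := rfl
    rw [this, sum_pair (by decide)]
    split_ifs with hc
    · simp [hc.neg_one_pow]; norm_num
    · simp [(Nat.not_even_iff_odd.1 hc).neg_one_pow]
  simp only [h1]
  have h3 := (Finset.prod_univ_sum (fun _ : ι ↦ (univ : Finset ℤˣ))
    fun e u ↦ ((u : ℤ) : ℂ) ^ M.count e).symm
  rw [Fintype.piFinset_univ] at h3
  rw [h3]
  simp only [h2]
  split_ifs with hM
  · rw [even_multiset_iff] at hM
    simp [hM]
  · rw [even_multiset_iff] at hM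
    push Not at hM
    obtain ⟨e, he⟩ := hM
    exact prod_eq_zero (mem_univ e) (if_neg he)

/-- The matrix with some of its entries multiplied by `-1`. -/
def signed {V : Type*} (s : V × V → ℤˣ) (X : Matrix V V ℂ) : Matrix V V ℂ :=
  Matrix.of fun x y ↦ ((s (x, y) : ℤ) : ℂ) * X x y

theorem halvesProd_signed {V : Type*} (s : V × V → ℤˣ) (X : Matrix V V ℂ) {k : ℕ}
    {w : Fin ((k + 1) + (k + 1)) → V} (hw : SameEnds w) :
    halvesProd (signed s X) w =
      ((wordEdges w).map fun e ↦ ((s e : ℤ) : ℂ)).prod * halvesProd X w := by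
  have hsq : ∀ e, ((s e : ℤ) : ℂ) * ((s e : ℤ) : ℂ) = 1 := fun e ↦ by
    rcases Int.units_eq_one_or (s e) with h | h <;> simp [h]
  have hprod : ((wordEdges w).map fun e ↦ ((s e : ℤ) : ℂ)).prod =
      (∏ t : Fin k, ((s (w (Fin.castAdd _ t.castSucc), w (Fin.castAdd _ t.succ)) : ℤ) : ℂ)) *
        ∏ t : Fin k, ((s (w (Fin.natAdd _ t.castSucc), w (Fin.natAdd _ t.succ)) : ℤ) : ℂ) := by
    rw [← prod_halves fun x y ↦ ((s (x, y) : ℤ) : ℂ)]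
    rw [wordEdges, Multiset.map_map]
    change ∏ u, ((s (w u, w (u + 1)) : ℤ) : ℂ) = _
    have hne : Fin.natAdd (k + 1) (Fin.last k) ≠ Fin.castAdd (k + 1) (Fin.last k) := fun h ↦ by
      have := Fin.ext_iff.1 h
      simp at this
    -- By `SameEnds` both closing steps use the same edge, so their signs cancel.
    rw [← mul_prod_erase univ _ (mem_univ (Fin.castAdd (k + 1) (Fin.last k))),
      ← mul_prod_erase _ _ (mem_erase.2 ⟨hne, mem_univ (Fin.natAdd (k + 1) (Fin.last k))⟩),
      ← mul_assoc, castAdd_last_add_one, natAdd_last_add_one, hw.2, hw.1, hsq, one_mul]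
    refine prod_congr ?_ fun _ _ ↦ rfl
    ext u
    simp [and_comm]
  rw [hprod]
  simp only [halvesProd, signed, Matrix.of_apply, map_mul, prod_mul_distrib, map_intCast]
  ring

theorem nnnorm_halvesProd {V : Type*} (X : Matrix V V ℂ) {k : ℕ} (w : Fin ((k + 1) + (k + 1)) → V) :
    ‖halvesProd X w‖₊ = wordWeight (fun x y ↦ ‖X x y‖₊) (Fin.castAdd (k + 1) (Fin.last k))
      (Fin.natAdd (k + 1) (Fin.last k)) w := by
  rw [wordWeight, prod_halves fun x y ↦ ‖X x y‖₊, halvesProd]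
  simp [nnnorm_mul]

open Classical in
/-- The average over the signs of the Frobenius norm of a power only involves even words. -/
theorem sum_signed_le (X : Matrix V V ℂ) (k : ℕ) :
    ∑ s : V × V → ℤˣ, ∑ i, ∑ j, ‖(signed s X ^ k) i j‖₊ ^ 2 ≤
      Fintype.card (V × V → ℤˣ) *
      ∑ w : Fin ((k + 1) + (k + 1)) → V with SameEnds w ∧ Even (wordEdges w),
        wordWeight (fun x y ↦ ‖X x y‖₊) (Fin.castAdd (k + 1) (Fin.last k))
          (Fin.natAdd (k + 1) (Fin.last k)) w := by
  have h1 : ((∑ s : V × V → ℤˣ, ∑ i, ∑ j, ‖(signed s X ^ k) i j‖ ^ 2 : ℝ) : ℂ) =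
      Fintype.card (V × V → ℤˣ) *
      ∑ w : Fin ((k + 1) + (k + 1)) → V with SameEnds w ∧ Even (wordEdges w), halvesProd X w := by
    rw [Complex.ofReal_sum]
    simp only [sum_norm_sq_pow_apply]
    rw [sum_comm, mul_sum, ← filter_filter, sum_filter fun w ↦ Even (wordEdges w)]
    refine sum_congr rfl fun w hw ↦ ?_
    rw [sum_congr rfl fun s _ ↦ halvesProd_signed s X (mem_filter.1 hw).2, ← sum_mul,
      sum_signs_prod]
    split_ifs <;> simp
  have h2 : (∑ s : V × V → ℤˣ, ∑ i, ∑ j, ‖(signed s X ^ k) i j‖₊ ^ 2) =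
      ‖((∑ s : V × V → ℤˣ, ∑ i, ∑ j, ‖(signed s X ^ k) i j‖ ^ 2 : ℝ) : ℂ)‖₊ := by
    refine NNReal.eq ?_
    rw [coe_nnnorm, Complex.norm_real, Real.norm_of_nonneg (by positivity)]
    push_cast
    rfl
  rw [h2, h1, nnnorm_mul, Complex.nnnorm_natCast]
  gcongr
  refine (nnnorm_sum_le _ _).trans (le_of_eq ?_)
  exact sum_congr rfl fun w _ ↦ nnnorm_halvesProd X w

/-- The average over the signs of the Frobenius norm of a power, under the truncation
hypothesis. -/
theorem sum_signed_le_of_cycleBound [Nonempty V] (X : Matrix V V ℂ) (k : ℕ) {K β : ℝ≥0}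
    (hK : 1 ≤ K) (hβ : 1 ≤ β) {η : ℝ} (hη : 0 < η)
    (hb : CycleBound (fun x y ↦ ‖X x y‖₊ ^ (2 * (1 + η))) K (Fintype.card V * β) (k + 1))
    (hKN : K * (Fintype.card V : ℝ≥0) ^ (-(η / (1 + η))) ≤ (((2 * (k + 1) : ℝ≥0) ^ 2)⁻¹) ^ 4) :
    ∑ s : V × V → ℤˣ, ∑ i, ∑ j, ‖(signed s X ^ k) i j‖₊ ^ 2 ≤
      Fintype.card (V × V → ℤˣ) *
        (6 * K * (2 * (k + 1)) ^ 2 * (Fintype.card V * β) ^ (k + 1)) := by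
  classical
  refine (sum_signed_le X k).trans ?_
  gcongr
  have hcast : (((k + 1) + (k + 1) : ℕ) : ℝ≥0) = 2 * (k + 1) := by push_cast; ring
  rw [← hcast] at hKN ⊢
  refine sum_even_wordWeight_le (by ring) hK hβ hη hb (fun h ↦ ?_) hKN _ fun w hw ↦ ?_
  · have := Fin.ext_iff.1 h
    simp at this
  · obtain ⟨hs, he⟩ := (mem_filter.1 hw).2
    exact ⟨he, hs.2, by rw [castAdd_last_add_one, natAdd_last_add_one]; exact hs.1.symm⟩

end signs

/-! ### Spectral radius and Frobenius norm. -/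

section spectral

open Finset
open scoped NNReal ENNReal

variable {V : Type*} [Fintype V] [DecidableEq V]

/-- The square of the Frobenius norm of a power of a matrix. -/
noncomputable def frobPow (k : ℕ) (A : Matrix V V ℂ) : ℝ≥0 := ∑ i, ∑ j, ‖(A ^ k) i j‖₊ ^ 2

section

attribute [local instance] Matrix.frobeniusNormedRing Matrix.frobeniusNormedAlgebra

/-- The identity has squared Frobenius norm `Fintype.card V`, whence this factor. -/
theorem nnnorm_pow_le_of_mem_spectrum {A : Matrix V V ℂ} {z : ℂ} (hz : z ∈ spectrum ℂ A) (k : ℕ) :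
    ‖z‖₊ ^ (2 * k) ≤ Fintype.card V * frobPow k A := by
  have : CompleteSpace (Matrix V V ℂ) := FiniteDimensional.complete ℂ _
  have h1 : ‖z ^ k‖₊ ≤ ‖A ^ k‖₊ * ‖(1 : Matrix V V ℂ)‖₊ :=
    spectrum.norm_le_norm_mul_of_mem (spectrum.pow_mem_pow A k hz)
  have h2 : ‖A ^ k‖₊ ^ 2 = frobPow k A := by
    have := Matrix.frobenius_nnnorm_def (A ^ k)
    rw [← NNReal.sqrt_eq_rpow] at this
    simp only [NNReal.rpow_two] at this
    rw [frobPow, ← NNReal.sq_sqrt (∑ i, ∑ j, ‖(A ^ k) i j‖₊ ^ 2)]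
    exact congrArg (· ^ 2) this
  have h3 : ‖(1 : Matrix V V ℂ)‖₊ ^ 2 = Fintype.card V := by
    have := Matrix.frobenius_nnnorm_one (n := V) (α := ℂ)
    rw [nnnorm_one (G := ℂ), mul_one] at this
    rw [← NNReal.sq_sqrt (Fintype.card V : ℝ≥0)]
    exact congrArg (· ^ 2) this
  calc ‖z‖₊ ^ (2 * k) = ‖z ^ k‖₊ ^ 2 := by rw [nnnorm_pow]; ring
    _ ≤ (‖A ^ k‖₊ * ‖(1 : Matrix V V ℂ)‖₊) ^ 2 := by gcongr
    _ = _ := by rw [mul_pow, h2, h3, mul_comm]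

end

theorem le_frobPow_of_le_spectralRadius {A : Matrix V V ℂ} {t : ℝ≥0} {k : ℕ} (hk : k ≠ 0)
    (h : (t : ℝ≥0∞) ≤ spectralRadius ℂ A) : t ^ (2 * k) ≤ Fintype.card V * frobPow k A := by
  by_contra! hlt
  set F := (Fintype.card V : ℝ≥0) * frobPow k A
  have hk2 : 2 * k ≠ 0 := by omega
  have hs : spectralRadius ℂ A ≤ ((F ^ ((2 * k : ℕ) : ℝ)⁻¹ : ℝ≥0) : ℝ≥0∞) := by
    refine iSup₂_le fun z hz ↦ ?_
    rw [ENNReal.coe_le_coe]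
    calc ‖z‖₊ = (‖z‖₊ ^ (2 * k)) ^ ((2 * k : ℕ) : ℝ)⁻¹ :=
        (NNReal.pow_rpow_inv_natCast _ hk2).symm
      _ ≤ _ := NNReal.rpow_le_rpow (nnnorm_pow_le_of_mem_spectrum hz k) (by positivity)
  have h1 := ENNReal.coe_le_coe.1 (h.trans hs)
  have h2 : t ^ (2 * k) ≤ F := by
    calc t ^ (2 * k) ≤ (F ^ ((2 * k : ℕ) : ℝ)⁻¹) ^ (2 * k) := by gcongr
      _ = F := NNReal.rpow_inv_natCast_pow _ hk2
  exact absurd h2 (not_le.2 hlt)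

end spectral

/-! ### Probability of the truncation event and tail of the Frobenius norm. -/

section probability

open Finset
open scoped NNReal ENNReal

variable {V : Type*} [Fintype V] [DecidableEq V]

/-- The matrix with given entries. -/
def toMat {V : Type*} (y : V × V → ℂ) : Matrix V V ℂ := Matrix.of fun i j ↦ y (i, j)

/-- The weights of the edges that enter the truncation. -/
noncomputable def entryWeight {V : Type*} (η : ℝ) (y : V × V → ℂ) (i j : V) : ℝ≥0 :=
  ‖y (i, j)‖₊ ^ (2 * (1 + η))

theorem measurable_entryWeight {V : Type*} (η : ℝ) (i j : V) :
    Measurable fun y : V × V → ℂ ↦ entryWeight η y i j := by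
  unfold entryWeight
  fun_prop

theorem measurable_pathSum (η : ℝ) (m : ℕ) :
    Measurable fun y : V × V → ℂ ↦ pathSum (entryWeight η y) m :=
  Finset.measurable_fun_sum _ fun _ _ ↦ Finset.measurable_fun_prod _ fun _ _ ↦
    measurable_entryWeight η _ _

theorem measurable_cycleSum (η : ℝ) (m : ℕ) :
    Measurable fun y : V × V → ℂ ↦ cycleSum (entryWeight η y) m :=
  Finset.measurable_fun_sum _ fun _ _ ↦ Finset.measurable_fun_prod _ fun _ _ ↦
    measurable_entryWeight η _ _

theorem measurableSet_cycleBound (η : ℝ) (K M : ℝ≥0) (L : ℕ) :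
    MeasurableSet {y : V × V → ℂ | CycleBound (entryWeight η y) K M L} := by
  simp only [CycleBound, Set.ofPred_forall, Set.ofPred_and]
  exact MeasurableSet.iInter fun m ↦ MeasurableSet.iInter fun _ ↦
    (measurableSet_le (measurable_cycleSum η m) measurable_const).inter
      (measurableSet_le (measurable_pathSum η m) measurable_const)

theorem measurable_frobPow (k : ℕ) :
    Measurable fun y : V × V → ℂ ↦ frobPow k (toMat y) := by
  have h1 : Continuous fun y : V × V → ℂ ↦ toMat y :=
    continuous_matrix fun i j ↦ continuous_apply (i, j)
  have h2 : ∀ i j, Continuous fun y : V × V → ℂ ↦ (toMat y ^ k) i j := fun i j ↦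
    (h1.pow k).matrix_elem i j
  refine Continuous.measurable ?_
  unfold frobPow
  exact continuous_finsetSum _ fun i _ ↦ continuous_finsetSum _ fun j _ ↦ ((h2 i j).nnnorm).pow 2

theorem lintegral_pi_prod {ι E : Type*} [Fintype ι] [MeasurableSpace E] (μ : Measure E)
    [IsProbabilityMeasure μ] {h : E → ℝ≥0∞} (hh : Measurable h) {m : ℕ} {e : Fin m → ι}
    (he : Function.Injective e) :
    ∫⁻ y, ∏ i, h (y (e i)) ∂(Measure.pi fun _ : ι ↦ μ) = (∫⁻ z, h z ∂μ) ^ m := by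
  have hind : iIndepFun (fun (p : ι) (y : ι → E) ↦ h (y p)) (Measure.pi fun _ ↦ μ) :=
    iIndepFun_pi (X := fun _ ↦ h) fun _ ↦ hh.aemeasurable
  have h1 := lintegral_prod_eq_prod_lintegral_of_indepFun univ (fun i (y : ι → E) ↦ h (y (e i)))
    (hind.precomp he) fun i ↦ hh.comp (measurable_pi_apply _)
  have h2 : ∀ p : ι, ∫⁻ y, h (y p) ∂(Measure.pi fun _ : ι ↦ μ) = ∫⁻ z, h z ∂μ := fun p ↦
    (measurePreserving_eval (fun _ : ι ↦ μ) p).lintegral_comp hh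
  rw [h1, prod_congr rfl fun i _ ↦ h2 (e i), prod_const, card_univ, Fintype.card_fin]

theorem lintegral_prod_entryWeight {V : Type*} [Fintype V] (μ : Measure ℂ)
    [IsProbabilityMeasure μ] (η : ℝ) {m : ℕ} {e : Fin m → V × V} (he : Function.Injective e) :
    ∫⁻ y, ((∏ i, entryWeight η y (e i).1 (e i).2 : ℝ≥0) : ℝ≥0∞) ∂(Measure.pi fun _ : V × V ↦ μ) =
      (∫⁻ z, ((‖z‖₊ ^ (2 * (1 + η)) : ℝ≥0) : ℝ≥0∞) ∂μ) ^ m := by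
  have hh : Measurable fun z : ℂ ↦ ((‖z‖₊ ^ (2 * (1 + η)) : ℝ≥0) : ℝ≥0∞) := by fun_prop
  rw [← lintegral_pi_prod μ hh he]
  refine lintegral_congr fun y ↦ ?_
  rw [ENNReal.ofNNReal_finsetProd]
  simp only [entryWeight, Prod.mk.eta]

/-- Distinct edges carry independent entries, so each term has mean at most `β ^ l`. Allowing `l ≤
m` treats paths, which have one edge fewer than vertices, together with cycles. -/
theorem lintegral_sum_le {m l : ℕ} (μ : Measure ℂ) [IsProbabilityMeasure μ] {η : ℝ} {β : ℝ≥0}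
    (hβ : 1 ≤ β) (hμ : ∫⁻ z, ((‖z‖₊ ^ (2 * (1 + η)) : ℝ≥0) : ℝ≥0∞) ∂μ ≤ β) (hl : l ≤ m)
    (e : (Fin m → V) → Fin l → V × V)
    (he : ∀ f, Function.Injective f → Function.Injective (e f)) :
    ∫⁻ y, ((∑ f : Fin m → V with Function.Injective f,
      ∏ i, entryWeight η y (e f i).1 (e f i).2 : ℝ≥0) : ℝ≥0∞) ∂(Measure.pi fun _ : V × V ↦ μ) ≤
      ((Fintype.card V * β) ^ m : ℝ≥0) := by
  simp only [ENNReal.ofNNReal_finsetSum]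
  rw [lintegral_finsetSum]
  · calc ∑ f : Fin m → V with Function.Injective f,
          ∫⁻ y, ((∏ i, entryWeight η y (e f i).1 (e f i).2 : ℝ≥0) : ℝ≥0∞)
            ∂(Measure.pi fun _ : V × V ↦ μ)
        ≤ ∑ f : Fin m → V with Function.Injective f, (β : ℝ≥0∞) ^ m := by
          refine sum_le_sum fun f hf ↦ ?_
          rw [lintegral_prod_entryWeight μ η (he f (mem_filter.1 hf).2)]
          calc _ ≤ (β : ℝ≥0∞) ^ l := by gcongr
            _ ≤ _ := pow_le_pow_right₀ (by exact_mod_cast hβ) hl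
      _ ≤ ∑ f : Fin m → V, (β : ℝ≥0∞) ^ m := sum_le_sum_of_subset (subset_univ _)
      _ = _ := by
        simp [mul_pow]
  · intro f _
    exact (Finset.measurable_fun_prod _ fun i _ ↦
      measurable_entryWeight η (e f i).1 (e f i).2).coe_nnreal_ennreal

theorem lintegral_pathSum_le (μ : Measure ℂ) [IsProbabilityMeasure μ] {η : ℝ} {β : ℝ≥0}
    (hβ : 1 ≤ β) (hμ : ∫⁻ z, ((‖z‖₊ ^ (2 * (1 + η)) : ℝ≥0) : ℝ≥0∞) ∂μ ≤ β) (m : ℕ) :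
    ∫⁻ y, (pathSum (entryWeight η y) m : ℝ≥0∞) ∂(Measure.pi fun _ : V × V ↦ μ) ≤
      ((Fintype.card V * β) ^ (m + 1) : ℝ≥0) :=
  lintegral_sum_le μ hβ hμ m.le_succ (fun f i ↦ (f i.castSucc, f i.succ)) fun _ hf _ _ hab ↦
    Fin.castSucc_injective _ (hf (Prod.ext_iff.1 hab).1)

theorem lintegral_cycleSum_le (μ : Measure ℂ) [IsProbabilityMeasure μ] {η : ℝ} {β : ℝ≥0}
    (hβ : 1 ≤ β) (hμ : ∫⁻ z, ((‖z‖₊ ^ (2 * (1 + η)) : ℝ≥0) : ℝ≥0∞) ∂μ ≤ β) (m : ℕ) :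
    ∫⁻ y, (cycleSum (entryWeight η y) m : ℝ≥0∞) ∂(Measure.pi fun _ : V × V ↦ μ) ≤
      ((Fintype.card V * β) ^ (m + 1) : ℝ≥0) :=
  lintegral_sum_le μ hβ hμ le_rfl (fun f i ↦ (f i, f (i + 1))) fun _ hf _ _ hab ↦
    hf (Prod.ext_iff.1 hab).1

theorem measure_lt_le_inv {Ω : Type*} [MeasurableSpace Ω] (P : Measure Ω) {f : Ω → ℝ≥0}
    (hf : Measurable f) {K A : ℝ≥0} (hK : 0 < K) (hA : 0 < A) (h : ∫⁻ ω, (f ω : ℝ≥0∞) ∂P ≤ A) :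
    P {ω | K * A < f ω} ≤ (K : ℝ≥0∞)⁻¹ := by
  have h1 := mul_meas_ge_le_lintegral (μ := P) hf.coe_nnreal_ennreal ((K * A : ℝ≥0) : ℝ≥0∞)
  have h2 : P {ω | K * A < f ω} ≤ P {ω | ((K * A : ℝ≥0) : ℝ≥0∞) ≤ f ω} :=
    measure_mono fun ω (hω : K * A < f ω) ↦ ENNReal.coe_le_coe.2 hω.le
  have hA' : (A : ℝ≥0∞) ≠ 0 := by exact_mod_cast hA.ne'
  have hK' : (K : ℝ≥0∞) ≠ 0 := by exact_mod_cast hK.ne'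
  refine h2.trans ?_
  rw [ENNReal.le_inv_iff_mul_le, ← ENNReal.mul_le_mul_iff_left hA' ENNReal.coe_ne_top, one_mul]
  refine le_trans (le_of_eq ?_) (h1.trans h)
  push_cast
  ring

theorem measure_not_cycleBound_le [Nonempty V] (μ : Measure ℂ) [IsProbabilityMeasure μ] {η : ℝ}
    {β K : ℝ≥0} (hK : 0 < K)
    (hβ : 1 ≤ β) (hμ : ∫⁻ z, ((‖z‖₊ ^ (2 * (1 + η)) : ℝ≥0) : ℝ≥0∞) ∂μ ≤ β) (L : ℕ) :
    (Measure.pi fun _ : V × V ↦ μ)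
      {y | ¬ CycleBound (entryWeight η y) K (Fintype.card V * β) L} ≤ 2 * L * (K : ℝ≥0∞)⁻¹ := by
  set Q := Measure.pi fun _ : V × V ↦ μ
  have hM : 0 < (Fintype.card V : ℝ≥0) * β :=
    mul_pos (by exact_mod_cast Fintype.card_pos) (zero_lt_one.trans_le hβ)
  have hsub : {y : V × V → ℂ | ¬ CycleBound (entryWeight η y) K (Fintype.card V * β) L} ⊆
      ⋃ m ∈ range L,
        ({y | K * (Fintype.card V * β) ^ (m + 1) < cycleSum (entryWeight η y) m} ∪
          {y | K * (Fintype.card V * β) ^ (m + 1) < pathSum (entryWeight η y) m}) := by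
    intro y hy
    simp only [CycleBound, Set.mem_ofPred_eq] at hy
    push Not at hy
    obtain ⟨m, hm, h⟩ := hy
    refine Set.mem_biUnion (by simpa using hm) ?_
    by_cases hc : cycleSum (entryWeight η y) m ≤ K * (Fintype.card V * β) ^ (m + 1)
    · exact Or.inr (h hc)
    · exact Or.inl (not_le.1 hc)
  calc _ ≤ _ := measure_mono hsub
    _ ≤ ∑ m ∈ range L, _ := measure_biUnion_finset_le _ _
    _ ≤ ∑ m ∈ range L, ((K : ℝ≥0∞)⁻¹ + (K : ℝ≥0∞)⁻¹) := by
      refine sum_le_sum fun m _ ↦ (measure_union_le _ _).trans (add_le_add ?_ ?_)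
      · exact measure_lt_le_inv Q (measurable_cycleSum η m) hK (pow_pos hM _)
          (lintegral_cycleSum_le μ hβ hμ m)
      · exact measure_lt_le_inv Q (measurable_pathSum η m) hK (pow_pos hM _)
          (lintegral_pathSum_le μ hβ hμ m)
    _ = _ := by
      rw [sum_const, card_range, nsmul_eq_mul]
      ring

theorem map_mul_sign (μ : Measure ℂ) (hneg : μ.map (fun z ↦ -z) = μ) (u : ℤˣ) :
    μ.map (fun z ↦ ((u : ℤ) : ℂ) * z) = μ := by
  rcases Int.units_eq_one_or u with rfl | rfl
  · simp
  · simpa using hneg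

theorem measurePreserving_signs {V : Type*} [Fintype V] (μ : Measure ℂ) [IsProbabilityMeasure μ]
    (hneg : μ.map (fun z ↦ -z) = μ) (s : V × V → ℤˣ) :
    MeasurePreserving (fun (y : V × V → ℂ) p ↦ ((s p : ℤ) : ℂ) * y p)
      (Measure.pi fun _ : V × V ↦ μ) (Measure.pi fun _ : V × V ↦ μ) := by
  refine ⟨by fun_prop, ?_⟩
  have hinst : ∀ p, IsProbabilityMeasure (μ.map fun z ↦ ((s p : ℤ) : ℂ) * z) := fun p ↦ by
    rw [map_mul_sign μ hneg]; infer_instance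
  rw [Measure.pi_map_pi (f := fun p z ↦ ((s p : ℤ) : ℂ) * z) fun p ↦ by fun_prop]
  simp only [map_mul_sign μ hneg]

/-- The first term is the probability that the truncation fails; the second is Markov's inequality
on the event where it holds. -/
theorem measure_le_frobPow_le [Nonempty V] (μ : Measure ℂ) [IsProbabilityMeasure μ]
    (hneg : μ.map (fun z ↦ -z) = μ) (k : ℕ) {K β : ℝ≥0} (hK : 1 ≤ K) (hβ : 1 ≤ β) {η : ℝ}
    (hη : 0 < η) (hμ : ∫⁻ z, ((‖z‖₊ ^ (2 * (1 + η)) : ℝ≥0) : ℝ≥0∞) ∂μ ≤ β)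
    (hKN : K * (Fintype.card V : ℝ≥0) ^ (-(η / (1 + η))) ≤ (((2 * (k + 1) : ℝ≥0) ^ 2)⁻¹) ^ 4)
    {c : ℝ≥0} (hc : 0 < c) :
    (Measure.pi fun _ : V × V ↦ μ) {y | c ≤ frobPow k (toMat y)} ≤
      ((2 * (k + 1) / K + 6 * K * (2 * (k + 1)) ^ 2 * (Fintype.card V * β) ^ (k + 1) / c : ℝ≥0) :
        ℝ≥0∞) := by
  set Q := Measure.pi fun _ : V × V ↦ μ with hQ
  set T : ℝ≥0 := 6 * K * (2 * (k + 1)) ^ 2 * (Fintype.card V * β) ^ (k + 1) with hT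
  let G : Set (V × V → ℂ) :=
    {y | CycleBound (entryWeight η y) K (Fintype.card V * β) (k + 1)}
  have hG : MeasurableSet G := measurableSet_cycleBound η K _ _
  have hF : Measurable fun y : V × V → ℂ ↦ (frobPow k (toMat y) : ℝ≥0∞) :=
    (measurable_frobPow k).coe_nnreal_ennreal
  let S := V × V → ℤˣ
  let act : S → (V × V → ℂ) → V × V → ℂ := fun s y p ↦ ((s p : ℤ) : ℂ) * y p
  have hact : ∀ s y, entryWeight η (act s y) = entryWeight η y := by
    intro s y
    funext i j
    have : ‖((s (i, j) : ℤ) : ℂ)‖₊ = 1 := by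
      rcases Int.units_eq_one_or (s (i, j)) with h | h <;> simp [h]
    simp only [entryWeight, act, nnnorm_mul, this, one_mul]
  have hpt : ∀ y, ∑ s : S, G.indicator (fun y ↦ (frobPow k (toMat y) : ℝ≥0∞)) (act s y) ≤
      (Fintype.card S : ℝ≥0∞) * T := by
    intro y
    by_cases hy : y ∈ G
    · have h1 : ∀ s, act s y ∈ G := fun s ↦ by
        change CycleBound (entryWeight η (act s y)) _ _ _
        rw [hact]
        exact hy
      have h2 : ∑ s : S, frobPow k (signed s (toMat y)) ≤ (Fintype.card S : ℝ≥0) * T :=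
        sum_signed_le_of_cycleBound (toMat y) k hK hβ hη hy hKN
      simp only [Set.indicator_of_mem (h1 _)]
      have h3 : ∀ s, toMat (act s y) = signed s (toMat y) := fun s ↦ rfl
      simp only [h3]
      exact_mod_cast h2
    · have h1 : ∀ s, act s y ∉ G := fun s hs ↦ by
        change CycleBound (entryWeight η (act s y)) _ _ _ at hs
        rw [hact] at hs
        exact hy hs
      simp only [Set.indicator_of_notMem (h1 _), sum_const_zero]
      exact zero_le
  have hcard0 : (Fintype.card S : ℝ≥0∞) ≠ 0 := by
    exact_mod_cast Fintype.card_ne_zero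
  have hint : ∫⁻ y, G.indicator (fun y ↦ (frobPow k (toMat y) : ℝ≥0∞)) y ∂Q ≤ T := by
    -- The law is invariant under every sign change, so the integral equals that of the average over
    -- signs, which is bounded pointwise.
    have h1 : (Fintype.card S : ℝ≥0∞) *
        ∫⁻ y, G.indicator (fun y ↦ (frobPow k (toMat y) : ℝ≥0∞)) y ∂Q =
        ∫⁻ y, ∑ s : S, G.indicator (fun y ↦ (frobPow k (toMat y) : ℝ≥0∞)) (act s y) ∂Q := by
      rw [lintegral_finsetSum]
      · have : ∀ s : S, ∫⁻ y, G.indicator (fun y ↦ (frobPow k (toMat y) : ℝ≥0∞)) (act s y) ∂Q =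
            ∫⁻ y, G.indicator (fun y ↦ (frobPow k (toMat y) : ℝ≥0∞)) y ∂Q := fun s ↦
          (measurePreserving_signs μ hneg s).lintegral_comp (hF.indicator hG)
        simp only [this, sum_const, card_univ, nsmul_eq_mul]
      · exact fun s _ ↦ (hF.indicator hG).comp (measurePreserving_signs μ hneg s).measurable
    have h2 : (Fintype.card S : ℝ≥0∞) *
        ∫⁻ y, G.indicator (fun y ↦ (frobPow k (toMat y) : ℝ≥0∞)) y ∂Q ≤ Fintype.card S * T := by
      rw [h1]
      calc _ ≤ ∫⁻ _, (Fintype.card S : ℝ≥0∞) * T ∂Q := lintegral_mono hpt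
        _ = _ := by simp [hQ]
    exact (ENNReal.mul_le_mul_iff_right hcard0 (ENNReal.natCast_ne_top _)).1 h2
  have hmk := mul_meas_ge_le_lintegral (μ := Q) (hF.indicator hG) (c : ℝ≥0∞)
  have hc0 : (c : ℝ≥0∞) ≠ 0 := by exact_mod_cast hc.ne'
  have hgood : Q {y | (c : ℝ≥0∞) ≤ G.indicator (fun y ↦ (frobPow k (toMat y) : ℝ≥0∞)) y} ≤
      ((T / c : ℝ≥0) : ℝ≥0∞) := by
    rw [ENNReal.coe_div hc.ne', ENNReal.le_div_iff_mul_le (Or.inl hc0) (Or.inl ENNReal.coe_ne_top),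
      mul_comm]
    exact hmk.trans hint
  have hbad : Q Gᶜ ≤ ((2 * (k + 1) / K : ℝ≥0) : ℝ≥0∞) := by
    refine (measure_not_cycleBound_le μ (zero_lt_one.trans_le hK) hβ hμ (k + 1)).trans
      (le_of_eq ?_)
    rw [ENNReal.coe_div (zero_lt_one.trans_le hK).ne', ENNReal.div_eq_inv_mul, mul_comm]
    push_cast
    rfl
  have hsub : {y | c ≤ frobPow k (toMat y)} ⊆
      Gᶜ ∪ {y | (c : ℝ≥0∞) ≤ G.indicator (fun y ↦ (frobPow k (toMat y) : ℝ≥0∞)) y} := by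
    intro y hy
    by_cases hyG : y ∈ G
    · refine Or.inr ?_
      change (c : ℝ≥0∞) ≤ _
      rw [Set.indicator_of_mem hyG]
      exact ENNReal.coe_le_coe.2 hy
    · exact Or.inl hyG
  rw [ENNReal.coe_add]
  exact (measure_mono hsub).trans ((measure_union_le _ _).trans (add_le_add hbad hgood))

end probability

/-! ### Estimates for k ≈ (log N)². -/

section asymptotics

open Filter

theorem eventually_mul_pow_le_exp {C θ : ℝ} (hC : 0 < C) (hθ : 0 < θ) (m : ℕ) :
    ∀ᶠ x : ℝ in atTop, C * (x ^ 2 + 2) ^ m ≤ Real.exp (θ * x) := by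
  have h := (isLittleO_pow_exp_pos_mul_atTop (2 * m) hθ).bound
    (show 0 < (C * 3 ^ m)⁻¹ by positivity)
  filter_upwards [h, eventually_ge_atTop 1] with x hx hx1
  rw [Real.norm_of_nonneg (by positivity), Real.norm_of_nonneg (by positivity),
    le_inv_mul_iff₀ (by positivity)] at hx
  refine le_trans ?_ hx
  have h1 : x ^ 2 + 2 ≤ 3 * x ^ 2 := by nlinarith
  calc C * (x ^ 2 + 2) ^ m ≤ C * (3 * x ^ 2) ^ m := by gcongr
    _ = _ := by rw [mul_pow, pow_mul]; ring

theorem exists_forall_ge_bounds {δ θ : ℝ} (hδ : 0 < δ) (hθ : 0 < θ) :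
    ∃ N₀ : ℕ, ∀ N : ℕ, N₀ ≤ N → 2 ≤ N → ∀ k : ℕ, k = ⌈Real.log N ^ 2⌉₊ →
      ((k : ℝ) + 1) ^ 2 * (N : ℝ) ^ (-θ) ≤ (((2 * ((k : ℝ) + 1)) ^ 2)⁻¹) ^ 4 ∧
      24 * ((k : ℝ) + 1) ^ 4 * (N : ℝ) ^ 2 * (1 + δ) / (1 + δ) ^ k ≤ 1 / ((k : ℝ) + 1) := by
  have hκ : 0 < Real.log (1 + δ) := Real.log_pos (by linarith)
  -- Here x = log N and k + 1 ≤ x² + 2. The degree 10 is 2 from `K` plus 8 from n⁸ = 256(k+1)⁸; the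
  -- degree 5 is 4 plus 1 for the required bound 1/(k+1).
  have hev := ((eventually_mul_pow_le_exp (C := 256) (by norm_num) hθ 10).and
    ((eventually_mul_pow_le_exp (C := 24 * (1 + δ)) (by positivity) one_pos 5).and
      (eventually_ge_atTop (3 / Real.log (1 + δ)))))
  obtain ⟨N₀, hN₀⟩ := eventually_atTop.1
    ((Real.tendsto_log_atTop.comp tendsto_natCast_atTop_atTop).eventually hev)
  refine ⟨N₀, fun N hN hN2 k hk ↦ ?_⟩
  obtain ⟨h1, h2, h3⟩ := hN₀ N hN
  simp only [Function.comp_apply] at h1 h2 h3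
  have hNpos : (0 : ℝ) < N := by positivity
  set x := Real.log N with hx
  have hNx : (N : ℝ) = Real.exp x := (Real.exp_log hNpos).symm
  have hx0 : 0 ≤ x := Real.log_nonneg (by exact_mod_cast (by omega : 1 ≤ N))
  have hk1 : x ^ 2 ≤ k := hk ▸ Nat.le_ceil _
  have hk2 : (k : ℝ) + 1 ≤ x ^ 2 + 2 := by
    have := Nat.ceil_lt_add_one (sq_nonneg x)
    rw [← hk] at this
    linarith
  constructor
  · have h4 : 256 * ((k : ℝ) + 1) ^ 10 ≤ Real.exp (θ * x) := le_trans (by gcongr) h1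
    rw [hNx, ← Real.exp_mul, show x * -θ = -(θ * x) by ring, Real.exp_neg, ← div_eq_mul_inv,
      inv_pow, div_le_iff₀ (Real.exp_pos _), ← div_eq_inv_mul, le_div_iff₀ (by positivity)]
    calc _ = 256 * ((k : ℝ) + 1) ^ 10 := by ring
      _ ≤ _ := h4
  · have h4 : 24 * (1 + δ) * ((k : ℝ) + 1) ^ 5 ≤ Real.exp (1 * x) := le_trans (by gcongr) h2
    -- The cube of N absorbs the N² of the claim and one more N for the polynomial in k.
    have h5 : Real.exp (3 * x) ≤ (1 + δ) ^ k := by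
      have h6 : (1 + δ) ^ k = Real.exp (k * Real.log (1 + δ)) := by
        rw [Real.exp_nat_mul, Real.exp_log (by linarith)]
      rw [h6]
      rw [div_le_iff₀ hκ] at h3
      refine Real.exp_le_exp.2 ?_
      calc 3 * x ≤ (x * Real.log (1 + δ)) * x := by gcongr
        _ = x ^ 2 * Real.log (1 + δ) := by ring
        _ ≤ _ := by gcongr
    rw [div_le_div_iff₀ (by positivity) (by positivity), one_mul]
    refine le_trans ?_ h5
    calc _ = (24 * (1 + δ) * ((k : ℝ) + 1) ^ 5) * (N : ℝ) ^ 2 := by ring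
      _ ≤ Real.exp (1 * x) * (N : ℝ) ^ 2 := by gcongr
      _ = Real.exp (3 * x) := by
        rw [hNx, ← Real.exp_nat_mul, ← Real.exp_add]
        congr 1
        push_cast
        ring

end asymptotics

/-! ### Interpolation of moments. -/

section moments

open scoped NNReal ENNReal

/-- The moments of orders between `2` and `2 + ε` are controlled by those of orders `2`
and `2 + ε`. -/
theorem lintegral_rpow_le_of_moments {Ω : Type*} [MeasurableSpace Ω] {P : Measure Ω}
    {x : Ω → ℂ} (hx : AEMeasurable x P) {ε B s : ℝ} (hε : 0 < ε) (hs0 : 0 ≤ s) (hs1 : s ≤ 1)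
    (h2 : ∫⁻ ω, ‖x ω‖ₑ ^ (2 : ℝ) ∂P ≤ 1)
    (hB : ∫⁻ ω, ‖x ω‖ₑ ^ (2 + ε) ∂P ≤ ENNReal.ofReal B) :
    ∫⁻ ω, ((‖x ω‖₊ ^ (2 + s * ε) : ℝ≥0) : ℝ≥0∞) ∂P ≤ 1 + ENNReal.ofReal (s * B) := by
  obtain ⟨w₁, hw₁⟩ : ∃ w : ℝ≥0, (w : ℝ) = 1 - s := ⟨⟨1 - s, by linarith⟩, rfl⟩
  obtain ⟨w₂, hw₂⟩ : ∃ w : ℝ≥0, (w : ℝ) = s := ⟨⟨s, hs0⟩, rfl⟩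
  have hw : w₁ + w₂ = 1 := NNReal.eq (by rw [NNReal.coe_add, hw₁, hw₂]; simp)
  -- Weighted AM-GM, as 2 + sε = (1-s)·2 + s(2+ε).
  have hpt : ∀ r : ℝ≥0, r ^ (2 + s * ε) ≤ w₁ * r ^ (2 : ℝ) + w₂ * r ^ (2 + ε) := by
    intro r
    refine le_trans (le_of_eq ?_)
      (NNReal.geom_mean_le_arith_mean2_weighted w₁ w₂ (r ^ (2 : ℝ)) (r ^ (2 + ε)) hw)
    rw [← NNReal.rpow_mul, ← NNReal.rpow_mul, ← NNReal.rpow_add_of_nonneg]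
    · congr 1
      rw [hw₁, hw₂]
      ring
    · positivity
    · positivity
  have hpt' : ∀ ω, ((‖x ω‖₊ ^ (2 + s * ε) : ℝ≥0) : ℝ≥0∞) ≤
      w₁ * ‖x ω‖ₑ ^ (2 : ℝ) + w₂ * ‖x ω‖ₑ ^ (2 + ε) := by
    intro ω
    have := ENNReal.coe_le_coe.2 (hpt ‖x ω‖₊)
    rwa [ENNReal.coe_add, ENNReal.coe_mul, ENNReal.coe_mul,
      ENNReal.coe_rpow_of_nonneg _ (show (0 : ℝ) ≤ 2 by norm_num),
      ENNReal.coe_rpow_of_nonneg _ (show (0 : ℝ) ≤ 2 + ε by linarith)] at this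
  calc _ ≤ ∫⁻ ω, (w₁ * ‖x ω‖ₑ ^ (2 : ℝ) + w₂ * ‖x ω‖ₑ ^ (2 + ε)) ∂P := lintegral_mono hpt'
    _ = w₁ * ∫⁻ ω, ‖x ω‖ₑ ^ (2 : ℝ) ∂P + w₂ * ∫⁻ ω, ‖x ω‖ₑ ^ (2 + ε) ∂P := by
      rw [lintegral_add_left' (by fun_prop), lintegral_const_mul'' _ (by fun_prop),
        lintegral_const_mul'' _ (by fun_prop)]
    _ ≤ 1 * 1 + w₂ * ENNReal.ofReal B := by
      gcongr
      exact_mod_cast le_self_add.trans hw.le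
    _ = _ := by
      rw [one_mul, ENNReal.ofReal_mul hs0]
      rw [← hw₂, ENNReal.ofReal_coe_nnreal]

end moments

/-! ### Choice of parameters and conclusion. -/

theorem theorem1p3 (ε δ B : ℝ) (hε : 0 < ε) (hδ : 0 < δ) (hB : 0 < B) :
    ∃ C : ℝ, 0 < C ∧
      ∀ N : ℕ, 2 ≤ N →
      -- a symmetric complex random variable `x`, with bounds on its moments of orders 2 and 2 + ε
      ∀ (Ω₀ : Type*) (_ : MeasurableSpace Ω₀) (P₀ : Measure Ω₀), IsProbabilityMeasure P₀ →
      ∀ x : Ω₀ → ℂ,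
        IdentDistrib x (fun ω ↦ -x ω) P₀ P₀ →
        ∫⁻ ω, ‖x ω‖ₑ ^ (2 : ℝ) ∂P₀ ≤ 1 →
        ∫⁻ ω, ‖x ω‖ₑ ^ (2 + ε) ∂P₀ ≤ ENNReal.ofReal B →
      -- a random `N × N` matrix whose entries are independent copies of `x`
      ∀ (Ω : Type*) (_ : MeasurableSpace Ω) (P : Measure Ω), IsProbabilityMeasure P →
      ∀ X : Ω → Matrix (Fin N) (Fin N) ℂ,
        iIndepFun (fun (p : Fin N × Fin N) ω ↦ X ω p.1 p.2) P →
        (∀ i j, IdentDistrib (fun ω ↦ X ω i j) x P P₀) →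
        P.real {ω | ENNReal.ofReal ((1 + δ) * √(N : ℝ)) ≤ spectralRadius ℂ (X ω)}
          ≤ C / (Real.log N) ^ 2 := by
  -- A small `s` keeps the moment of order 2 + sε = 2(1+η) below 1 + δ. Since t^(2k) contains
  -- (1+δ)^(2k), a surplus (1+δ)^k survives.
  obtain ⟨s, hs0, hs1, hsB⟩ : ∃ s : ℝ, 0 < s ∧ s ≤ 1 ∧ s * B ≤ δ := by
    refine ⟨min 1 (δ / B), by positivity, min_le_left _ _, ?_⟩
    calc min 1 (δ / B) * B ≤ δ / B * B := by gcongr; exact min_le_right _ _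
      _ = δ := by field_simp
  obtain ⟨η, hη⟩ : ∃ η, η = s * ε / 2 := ⟨_, rfl⟩
  have hη0 : 0 < η := by rw [hη]; positivity
  obtain ⟨N₀, hN₀⟩ := exists_forall_ge_bounds hδ (show 0 < η / (1 + η) by positivity)
  -- The logarithm makes the bound trivial for `N < N₀`; the 3 is 2 from the truncation plus 1 from
  -- Markov's inequality.
  refine ⟨3 + Real.log N₀ ^ 2, by positivity, ?_⟩
  intro N hN2 Ω₀ _ P₀ hP₀ x hsymm hx2 hxB Ω _ P hP X hind hid
  have hN1 : (1 : ℝ) < N := by exact_mod_cast hN2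
  have hlog : 0 < Real.log N := Real.log_pos hN1
  rcases lt_or_ge N N₀ with hlt | hge
  · refine measureReal_le_one.trans ?_
    rw [le_div_iff₀ (by positivity), one_mul]
    have : Real.log N ^ 2 ≤ Real.log N₀ ^ 2 := by gcongr
    linarith
  obtain ⟨k, hk⟩ : ∃ k, k = ⌈Real.log N ^ 2⌉₊ := ⟨_, rfl⟩
  obtain ⟨h1, h2⟩ := hN₀ N hge hN2 k hk
  have hkpos : 0 < k := by rw [hk]; exact Nat.ceil_pos.2 (by positivity)
  have hNe : Nonempty (Fin N) := ⟨⟨0, by omega⟩⟩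
  set μ : Measure ℂ := P₀.map x with hμ
  have hxm : AEMeasurable x P₀ := hsymm.aemeasurable_fst
  have hμP : IsProbabilityMeasure μ := Measure.isProbabilityMeasure_map hxm
  have hneg : μ.map (fun z ↦ -z) = μ := by
    rw [hμ, AEMeasurable.map_map_of_aemeasurable measurable_neg.aemeasurable hxm]
    exact hsymm.map_eq.symm
  obtain ⟨β, hβδ⟩ : ∃ β : NNReal, (β : ℝ) = 1 + δ := ⟨⟨1 + δ, by positivity⟩, rfl⟩
  have hβ : 1 ≤ β := NNReal.coe_le_coe.1 (by rw [hβδ, NNReal.coe_one]; linarith)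
  have hmom : ∫⁻ z, ((‖z‖₊ ^ (2 * (1 + η)) : NNReal) : ENNReal) ∂μ ≤ β := by
    have hm : Measurable fun z : ℂ ↦ ((‖z‖₊ ^ (2 * (1 + η)) : NNReal) : ENNReal) := by fun_prop
    rw [hμ, lintegral_map' hm.aemeasurable hxm]
    have := lintegral_rpow_le_of_moments hxm hε hs0.le hs1 hx2 hxB
    rw [show 2 * (1 + η) = 2 + s * ε by rw [hη]; ring]
    refine this.trans ?_
    rw [← ENNReal.ofReal_coe_nnreal, hβδ,
      ENNReal.ofReal_add zero_le_one hδ.le, ENNReal.ofReal_one]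
    gcongr
  let Y : Ω → Fin N × Fin N → ℂ := fun ω p ↦ X ω p.1 p.2
  have hYm : ∀ p : Fin N × Fin N, AEMeasurable (fun ω ↦ X ω p.1 p.2) P := fun p ↦
    (hid p.1 p.2).aemeasurable_fst
  have hY : AEMeasurable Y P := aemeasurable_pi_lambda _ hYm
  have hlaw : P.map Y = Measure.pi fun _ : Fin N × Fin N ↦ μ := by
    rw [(iIndepFun_iff_map_fun_eq_pi_map hYm).1 hind]
    congr 1
    funext p
    exact (hid p.1 p.2).map_eq
  obtain ⟨t, ht⟩ : ∃ t : NNReal, (t : ℝ) = (1 + δ) * √(N : ℝ) :=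
    ⟨⟨(1 + δ) * √(N : ℝ), by positivity⟩, rfl⟩
  let c : NNReal := t ^ (2 * k) / N
  have hNNR : (0 : NNReal) < N := by exact_mod_cast (by omega : 0 < N)
  have ht0 : 0 < t := NNReal.coe_pos.1 (by rw [ht]; positivity)
  have hc : 0 < c := div_pos (pow_pos ht0 _) hNNR
  -- This makes the truncation fail with probability at most 2/(k+1), while `K` stays negligible
  -- against powers of `N`.
  let K : NNReal := (k + 1) ^ 2
  have hK : 1 ≤ K := one_le_pow₀ le_add_self
  have hKN : K * (Fintype.card (Fin N) : NNReal) ^ (-(η / (1 + η))) ≤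
      (((2 * (k + 1) : NNReal) ^ 2)⁻¹) ^ 4 := by
    rw [Fintype.card_fin, ← NNReal.coe_le_coe]
    push_cast
    exact h1
  have hmain := measure_le_frobPow_le μ hneg k hK hβ hη0 hmom hKN hc
  rw [← hlaw, Measure.map_apply_of_aemeasurable hY
    (measurableSet_le measurable_const (measurable_frobPow k)), Fintype.card_fin] at hmain
  have hsub : {ω | ENNReal.ofReal ((1 + δ) * √(N : ℝ)) ≤ spectralRadius ℂ (X ω)} ⊆
      Y ⁻¹' {y | c ≤ frobPow k (toMat y)} := by
    intro ω hω
    change c ≤ frobPow k (X ω)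
    have h3 : (t : ENNReal) ≤ spectralRadius ℂ (X ω) := by
      rw [← ENNReal.ofReal_coe_nnreal, ht]
      exact hω
    have h4 := le_frobPow_of_le_spectralRadius hkpos.ne' h3
    rw [Fintype.card_fin] at h4
    exact (div_le_iff₀' hNNR).2 h4
  have hfin := ENNReal.toReal_mono ENNReal.coe_ne_top ((measure_mono hsub).trans hmain)
  refine hfin.trans ?_
  rw [ENNReal.coe_toReal]
  have hkR : (0 : ℝ) < (k : ℝ) + 1 := by positivity
  have hlk : Real.log N ^ 2 ≤ (k : ℝ) + 1 := by
    have : Real.log N ^ 2 ≤ k := hk ▸ Nat.le_ceil _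
    linarith
  have ht2 : ((1 + δ) * √(N : ℝ)) ^ (2 * k) = (1 + δ) ^ (2 * k) * (N : ℝ) ^ k := by
    rw [mul_pow, pow_mul (√(N : ℝ)), Real.sq_sqrt (by positivity)]
  have hval : ((2 * (k + 1) / K + 6 * K * (2 * (k + 1)) ^ 2 * (N * β) ^ (k + 1) / c : NNReal) : ℝ) =
      2 / ((k : ℝ) + 1) +
        24 * ((k : ℝ) + 1) ^ 4 * (N : ℝ) ^ 2 * (1 + δ) / (1 + δ) ^ k := by
    simp only [K, c, NNReal.coe_add, NNReal.coe_div, NNReal.coe_mul, NNReal.coe_pow,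
      NNReal.coe_natCast, NNReal.coe_one, NNReal.coe_ofNat, hβδ, ht, ht2]
    have hd : (1 + δ) ≠ 0 := by positivity
    have hN0 : (N : ℝ) ≠ 0 := by positivity
    congr 1
    · field_simp
    · rw [mul_pow (N : ℝ), pow_succ (N : ℝ) k, pow_succ (1 + δ) k, two_mul k, pow_add (1 + δ) k k]
      field_simp
      ring
  rw [hval]
  calc _ ≤ 2 / ((k : ℝ) + 1) + 1 / ((k : ℝ) + 1) := by gcongr
    _ = 3 / ((k : ℝ) + 1) := by ring
    _ ≤ 3 / Real.log N ^ 2 := by gcongr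
    _ ≤ _ := by
      gcongr
      linarith [sq_nonneg (Real.log N₀)]
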